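/- For $a>0$, $n\in\mathbb{Z}_{\ge 0}$ and $z\in\mathbb{C}$ let $$c_n^a(z)=\sum_{k=0}^n\binom{n}{k}\binom{z}{k}\,k!\,(-a)^{-k},\qquad \binom{z}{k}=\frac{z(z-1)\cdots(z-k+1)}{k!},$$ be the Charlier polynomials, and for $\nu,x\in\mathbb{C}$ let $$H_\nu(x)=2^\nu\sqrt{\pi}\left[\frac{1}{\Gamma\left(\frac{1-\nu}{2}\right)}M\!\left(-\tfrac{\nu}{2};\tfrac12;x^2\right)-\frac{2x}{\Gamma\left(-\frac{\nu}{2}\right)}M\!\left(\tfrac{1-\nu}{2};\tfrac32;x^2\right)\right]$$ be the Hermite function, where $M(\alpha;\beta;z)=\sum_{k\ge0}\frac{(\alpha)_k}{(\beta)_k}\frac{z^k}{k!}$ is the confluent hypergeometric function of the first kind and $1/\Gamma$ is understood as $0$ at the poles of $\Gamma$. Fix a real number $x$ and, for $a>0$ so large that $a - x\sqrt{2a}\ge 0$, put $n(a)=\lfloor a-x\sqrt{2a}\rfloor$. (i) Let $(a_i)$ be a family of real numbers with $a_i\to\infty$ (along a sequence, or along any proper filter; in particular $a_i = a$ may be the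 real parameter $a\to\infty$ itself), and let $\nu_i$ be (real or complex) numbers such that $c^{a_i}_{n(a_i)}(\nu_i)=0$ eventually and $\nu_i\to\nu$. Then $H_\nu(x)=0$ and $\nu=\nu_i+O(1/\sqrt{a_i})$. (ii) Conversely, for every real $\nu$ with $H_\nu(x)=0$ there are real numbers $\nu(a)$, $a>0$, such that $c^{a}_{n(a)}(\nu(a))=0$ for all sufficiently large real $a$, $\nu(a)\to\nu$ as $a\to\infty$, and $\nu=\nu(a)+O(1/\sqrt{a})$ as $a\to\infty$. -/

import Mathlib

open Filter Topology Asymptotics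

noncomputable section

/-- The generalized binomial coefficient `z (z - 1) ⋯ (z - k + 1) / k!` for complex `z`. -/
def genBinom (z : ℂ) (k : ℕ) : ℂ :=
  (∏ j ∈ Finset.range k, (z - (j : ℂ))) / (k.factorial : ℂ)

/-- The Charlier polynomial `c_n^a(z) = ∑_{k=0}^n C(n,k) C(z,k) k! (-a)^{-k}`. -/
def charlier (a : ℝ) (n : ℕ) (z : ℂ) : ℂ :=
  ∑ k ∈ Finset.range (n + 1),
    (n.choose k : ℂ) * genBinom z k * (k.factorial : ℂ) * (-(a : ℂ)) ^ (-(k : ℤ))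

/-- Kummer's confluent hypergeometric function of the first kind
`M(α; β; z) = ∑_k (α)_k / (β)_k * z^k / k!`, where `(α)_k` is the rising factorial.
The series converges for all `α`, `z` when `β` is not a non-positive integer
(below, `β` is `1/2` or `3/2`). -/
def kummerM (α β z : ℂ) : ℂ :=
  ∑' k : ℕ, (ascPochhammer ℂ k).eval α / (ascPochhammer ℂ k).eval β
    * z ^ k / (k.factorial : ℂ)

/-- The Hermite function `H_ν(x)` of degree `ν`. At the poles of `Γ` Mathlib has
`Complex.Gamma s = 0`, hence `(Complex.Gamma s)⁻¹ = 0`, which is the limiting value of `1 / Γ`. -/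
def hermiteFn (ν x : ℂ) : ℂ :=
  (2 : ℂ) ^ ν * (√Real.pi : ℂ) *
    ((Complex.Gamma ((1 - ν) / 2))⁻¹ * kummerM (-ν / 2) (1 / 2) (x ^ 2)
      - 2 * x * (Complex.Gamma (-ν / 2))⁻¹ * kummerM ((1 - ν) / 2) (3 / 2) (x ^ 2))

/-- The degree `n = ⌊a - x √(2a)⌋`, nonnegative for all large `a`
(and truncated to `0` otherwise). -/
def charlierDegree (x a : ℝ) : ℕ := ⌊a - x * √(2 * a)⌋₊

end

/-!
Put `b = √(2a)` and scale the Charlier polynomial by `b ^ z` (`scaledCharlier`). For a degree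
`n = a - X b` (so `X = hermitePoint b n`) and `Re z < 0`, the product of `Γ(-z)` with the scaled
polynomial is the Mellin transform of `exp (-b t) (1 + 2t / b) ^ n`. This kernel is within
`O(1 / b)` of `exp (-t² - 2 X t)`, whose Mellin transform is `Γ(-z) H_z(X)`. Since the difference
equation in `z` of the Charlier polynomials tends to the recurrence `H_{z+1} = 2x H_z - 2z H_{z-1}`,
the approximation with error `O(1 / b)` extends to all compact sets of the `z`-plane
(`convergesOn_of_isCompact`). In particular `H_z(x)` is entire in `z`.

The convergence of zeros at the rate `O(1 / √a)` then rests on the zeros `ν` of `H_ν(x)` being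
simple. Limits of zeros of Charlier polynomials are real (`im_eq_zero_of_charlier_eq_zero`), so it
suffices to consider real `ν`. There the Wronskian in `z` of consecutive scaled polynomials is, by
the confluent Christoffel–Darboux formula, a weighted sum of squares of scaled polynomials of lower
degree. Those degrees correspond to points `t > x`; as `H_ν(t) > 0` for large `t`, the
sum is at least a multiple of `1 / b` (`charlierWronskian_lower`). A multiple zero would make it
`O(1 / b ^ 2)`, whence `deriv_hermiteFn_ne_zero`. This replaces the Sturm–Liouville argument on
`[x, ∞)` by a finite sum and needs no analysis of `H_ν(t)` as a function of `t`.

Given simplicity, zeros `z` of Charlier polynomials near `ν` satisfy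
`|z - ν| ≲ |H_z(x)| = O(1 / b)`, and conversely the sign change of `H` at a real zero
forces, by the intermediate value theorem, a real zero of the Charlier polynomial within `O(1 / b)` (`exists_charlier_zero_near`).
-/

/-! ### Recurrences for Charlier polynomials -/

lemma charlier_eq_sum (a : ℝ) (n : ℕ) (z : ℂ) :
    charlier a n z = ∑ k ∈ Finset.range (n + 1),
      (n.choose k : ℂ) * (∏ j ∈ Finset.range k, (z - (j : ℂ))) * ((-(a : ℂ))⁻¹) ^ k := by
  unfold charlier genBinom
  refine Finset.sum_congr rfl fun k _ => ?_
  have hk : (k.factorial : ℂ) ≠ 0 := by exact_mod_cast k.factorial_ne_zero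
  rw [zpow_neg, zpow_natCast, inv_pow]
  field_simp

lemma charlier_zero (a : ℝ) (z : ℂ) : charlier a 0 z = 1 := by
  simp [charlier_eq_sum]

lemma prod_range_succ_sub (z : ℂ) (k : ℕ) :
    ∏ j ∈ Finset.range (k + 1), (z - (j : ℂ)) =
      z * ∏ j ∈ Finset.range k, (z - 1 - (j : ℂ)) := by
  rw [Finset.prod_range_succ', mul_comm]
  simp [sub_sub, add_comm]

/-- The forward difference in the degree shifts the variable. -/
lemma charlier_succ (a : ℝ) (n : ℕ) (z : ℂ) :
    charlier a (n + 1) z = charlier a n z - z / a * charlier a n (z - 1) := by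
  have hn : charlier a n z = 1 + ∑ k ∈ Finset.range (n + 1), (n.choose (k + 1) : ℂ) *
      (∏ j ∈ Finset.range (k + 1), (z - (j : ℂ))) * ((-(a : ℂ))⁻¹) ^ (k + 1) := by
    rw [charlier_eq_sum, add_comm (1 : ℂ)]
    have := Finset.sum_range_succ' (fun k => (n.choose k : ℂ) *
      (∏ j ∈ Finset.range k, (z - (j : ℂ))) * ((-(a : ℂ))⁻¹) ^ k) (n + 1)
    rw [Finset.sum_range_succ] at this
    simpa using this
  rw [hn, charlier_eq_sum a (n + 1), charlier_eq_sum a n (z - 1), Finset.sum_range_succ',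
    Finset.mul_sum, add_sub_assoc, ← Finset.sum_sub_distrib, add_comm]
  congr 1
  · simp
  · refine Finset.sum_congr rfl fun k _ => ?_
    rw [Nat.choose_succ_succ, prod_range_succ_sub, pow_succ, inv_neg, div_eq_mul_inv]
    push_cast
    ring

/-- The difference equation in the variable `z`, the discrete counterpart of the recurrence
`H_{z+1} = 2x H_z - 2z H_{z-1}`. -/
lemma charlier_add_one {a : ℝ} (ha : a ≠ 0) (n : ℕ) (z : ℂ) :
    a * charlier a n (z + 1) = (z + a - n) * charlier a n z - z * charlier a n (z - 1) := by
  have ha' : (a : ℂ) ≠ 0 := by exact_mod_cast ha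
  induction n generalizing z with
  | zero => simp [charlier_zero]
  | succ n ih =>
    have h1 := ih z
    have h2 := ih (z - 1)
    simp only [charlier_succ, sub_add_cancel, add_sub_cancel_right] at h1 h2 ⊢
    push_cast
    field_simp
    linear_combination a * h1 - z * h2

/-- The three-term recurrence of the Charlier polynomials as orthogonal polynomials in `z`. -/
lemma charlier_succ_succ {a : ℝ} (ha : a ≠ 0) (n : ℕ) (z : ℂ) :
    a * charlier a (n + 2) z =
      (n + 1 + a - z) * charlier a (n + 1) z - (n + 1) * charlier a n z := by
  have ha' : (a : ℂ) ≠ 0 := by exact_mod_cast ha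
  have h := charlier_add_one ha n (z - 1)
  simp only [charlier_succ, sub_add_cancel] at h ⊢
  field_simp
  linear_combination z * h

/-- Off the real axis the recurrence in the degree propagates the sign of
`Im (c_k(z) * conj (c_{k+1}(z)))`, which therefore never vanishes; hence Charlier polynomials have
only real zeros. Taking `σ = z.im` covers both half-planes. -/
lemma charlier_wronskian_im {a : ℝ} (ha : 0 < a) {z : ℂ} {σ : ℝ} (hz : 0 < σ * z.im) (k : ℕ) :
    0 < σ * (charlier a k z * (starRingEnd ℂ) (charlier a (k + 1) z)).im := by
  induction k with
  | zero =>
    have : charlier a 1 z = 1 - z / a := by simp [charlier_succ, charlier_zero]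
    rw [zero_add, this, charlier_zero]
    simp only [one_mul, map_sub, map_one, map_div₀, Complex.conj_ofReal, Complex.sub_im,
      Complex.one_im, Complex.div_ofReal_im, Complex.conj_im, zero_sub, neg_neg, neg_div]
    rw [← mul_div_assoc]
    positivity
  | succ k ih =>
    have h := charlier_succ_succ ha.ne' k z
    have hc := congrArg (fun w => (charlier a (k + 1) z * (starRingEnd ℂ) w).im) h
    simp only [map_sub, map_mul, map_add, Complex.conj_ofReal, map_one, map_natCast] at hc
    have key : a * (charlier a (k + 1) z * (starRingEnd ℂ) (charlier a (k + 2) z)).im =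
        z.im * Complex.normSq (charlier a (k + 1) z) +
        (k + 1) * (charlier a k z * (starRingEnd ℂ) (charlier a (k + 1) z)).im := by
      simp only [Complex.mul_im, Complex.mul_re, Complex.sub_im, Complex.sub_re, Complex.add_im,
        Complex.add_re, Complex.conj_re, Complex.conj_im, Complex.ofReal_re, Complex.ofReal_im,
        Complex.one_re, Complex.one_im, Complex.natCast_re, Complex.natCast_im,
        Complex.normSq_apply] at hc ⊢
      linear_combination hc
    have hσ : a * (σ * (charlier a (k + 1) z *
        (starRingEnd ℂ) (charlier a (k + 1 + 1) z)).im) =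
        σ * z.im * Complex.normSq (charlier a (k + 1) z) +
        (k + 1) * (σ * (charlier a k z * (starRingEnd ℂ) (charlier a (k + 1) z)).im) := by
      linear_combination σ * key
    have := Complex.normSq_nonneg (charlier a (k + 1) z)
    refine pos_of_mul_pos_right (a := a) ?_ ha.le
    rw [hσ]
    positivity

lemma im_eq_zero_of_charlier_eq_zero {a : ℝ} (ha : 0 < a) {n : ℕ} {z : ℂ}
    (h : charlier a n z = 0) : z.im = 0 := by
  by_contra hz
  obtain _ | n := n
  · simp [charlier_zero] at h
  · have := charlier_wronskian_im ha (z := z) (σ := z.im) (mul_self_pos.2 hz) n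
    simp [h] at this

lemma charlier_ofReal_im (a : ℝ) (n : ℕ) (s : ℝ) : (charlier a n (s : ℂ)).im = 0 := by
  induction n generalizing s with
  | zero => simp [charlier_zero]
  | succ n ih =>
    have h1 := ih s
    have h2 := ih (s - 1)
    rw [charlier_succ]
    push_cast at h2
    rw [← Complex.ofReal_div]
    simp [h1, h2, Complex.mul_im]

lemma differentiable_charlier (a : ℝ) (n : ℕ) : Differentiable ℂ (charlier a n) := by
  have : charlier a n = fun z => ∑ k ∈ Finset.range (n + 1),
      (n.choose k : ℂ) * (∏ j ∈ Finset.range k, (z - (j : ℂ))) * ((-(a : ℂ))⁻¹) ^ k :=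
    funext (charlier_eq_sum a n)
  rw [this]
  fun_prop

/-! ### Scaled Charlier polynomials -/

/-- The Charlier polynomial with parameter `a = b² / 2`, scaled by `b ^ z = (2a)^(z/2)`; this is
the normalization in which it converges to the Hermite function as `b → ∞`. -/
noncomputable def scaledCharlier (b : ℝ) (n : ℕ) (z : ℂ) : ℂ :=
  (b : ℂ) ^ z * charlier (b ^ 2 / 2) n z

/-- The argument of the limiting Hermite function belonging to the degree `n`, that is, the
number `X` with `n = a - X √(2a)` where `a = b² / 2`. -/
noncomputable def hermitePoint (b : ℝ) (n : ℕ) : ℝ := (b ^ 2 / 2 - n) / b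

lemma scaledCharlier_eq_zero_iff {b : ℝ} (hb : 0 < b) {n : ℕ} {z : ℂ} :
    scaledCharlier b n z = 0 ↔ charlier (b ^ 2 / 2) n z = 0 := by
  have hb' : (b : ℂ) ≠ 0 := by exact_mod_cast hb.ne'
  simp [scaledCharlier, Complex.cpow_eq_zero_iff, hb']

lemma differentiable_scaledCharlier {b : ℝ} (hb : 0 < b) (n : ℕ) :
    Differentiable ℂ (scaledCharlier b n) := by
  have hb' : (b : ℂ) ≠ 0 := by exact_mod_cast hb.ne'
  exact (differentiable_id.const_cpow (Or.inl hb')).mul (differentiable_charlier _ n)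

lemma scaledCharlier_ofReal_im {b : ℝ} (hb : 0 < b) (n : ℕ) (s : ℝ) :
    (scaledCharlier b n (s : ℂ)).im = 0 := by
  rw [scaledCharlier, ← Complex.ofReal_cpow hb.le, Complex.im_ofReal_mul, charlier_ofReal_im,
    mul_zero]

lemma scaledCharlier_succ {b : ℝ} (hb : 0 < b) (n : ℕ) (z : ℂ) :
    scaledCharlier b (n + 1) z =
      scaledCharlier b n z - 2 * z / b * scaledCharlier b n (z - 1) := by
  have hb' : (b : ℂ) ≠ 0 := by exact_mod_cast hb.ne'
  simp only [scaledCharlier, charlier_succ, Complex.cpow_sub _ _ hb', Complex.cpow_one]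
  push_cast
  field_simp

lemma scaledCharlier_add_one {b : ℝ} (hb : 0 < b) (n : ℕ) (z : ℂ) :
    scaledCharlier b n (z + 1) =
      (2 * hermitePoint b n + 2 * z / b) * scaledCharlier b n z
        - 2 * z * scaledCharlier b n (z - 1) := by
  have hb' : (b : ℂ) ≠ 0 := by exact_mod_cast hb.ne'
  have h := charlier_add_one (a := b ^ 2 / 2) (by positivity) n z
  simp only [scaledCharlier, hermitePoint, Complex.cpow_sub _ _ hb', Complex.cpow_add _ _ hb',
    Complex.cpow_one]
  push_cast at h ⊢
  field_simp
  linear_combination 2 * (b : ℂ) ^ z * h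

lemma scaledCharlier_succ_succ {b : ℝ} (hb : 0 < b) (n : ℕ) (z : ℂ) :
    (b : ℂ) ^ 2 / 2 * scaledCharlier b (n + 2) z =
      (n + 1 + (b : ℂ) ^ 2 / 2 - z) * scaledCharlier b (n + 1) z
        - (n + 1) * scaledCharlier b n z := by
  have h := charlier_succ_succ (a := b ^ 2 / 2) (by positivity) n z
  push_cast at h
  simp only [scaledCharlier]
  linear_combination (b : ℂ) ^ z * h

lemma scaledCharlier_zero (b : ℝ) (z : ℂ) : scaledCharlier b 0 z = (b : ℂ) ^ z := by
  simp [scaledCharlier, charlier_zero]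

/-! ### Kummer's function and the recurrence for Hermite functions -/

lemma ascPochhammer_eval_succ_left (α : ℂ) (k : ℕ) :
    (ascPochhammer ℂ (k + 1)).eval α = α * (ascPochhammer ℂ k).eval (α + 1) := by
  simp [ascPochhammer_succ_left, Polynomial.eval_comp]

lemma ascPochhammer_eval_ne_zero {β : ℂ} (hβ : 0 < β.re) (k : ℕ) :
    (ascPochhammer ℂ k).eval β ≠ 0 := by
  induction k with
  | zero => simp
  | succ k ih =>
    rw [ascPochhammer_succ_eval]
    refine mul_ne_zero ih fun h => ?_
    have := congrArg Complex.re h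
    simp at this
    have hk : (0 : ℝ) ≤ k := k.cast_nonneg
    linarith

lemma summable_kummerM (α β z : ℂ) :
    Summable fun k : ℕ => (ascPochhammer ℂ k).eval α / (ascPochhammer ℂ k).eval β
      * z ^ k / (k.factorial : ℂ) := by
  refine summable_of_ratio_norm_eventually_le (r := 1 / 2) (by norm_num) ?_
  filter_upwards [eventually_ge_atTop ⌈‖β‖ + 2 * (‖α‖ + 1) * ‖z‖ + 1⌉₊] with k hk
  have hk' : ‖β‖ + 2 * (‖α‖ + 1) * ‖z‖ + 1 ≤ k := Nat.ceil_le.1 hk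
  have e : (ascPochhammer ℂ (k + 1)).eval α / (ascPochhammer ℂ (k + 1)).eval β
      * z ^ (k + 1) / ((k + 1).factorial : ℂ) = ((α + k) / (k + 1) * (z / (β + k))) *
      ((ascPochhammer ℂ k).eval α / (ascPochhammer ℂ k).eval β * z ^ k / (k.factorial : ℂ)) := by
    rw [ascPochhammer_succ_eval, ascPochhammer_succ_eval, Nat.factorial_succ]
    push_cast
    simp only [div_eq_mul_inv, mul_inv, pow_succ]
    ring
  rw [e, norm_mul]
  gcongr
  rw [norm_mul]
  have h1 : ‖(α + k) / (k + 1)‖ ≤ ‖α‖ + 1 := by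
    have hn : ‖((k : ℂ) + 1)‖ = k + 1 := by
      rw [← Nat.cast_succ, Complex.norm_natCast]; push_cast; ring
    rw [norm_div, hn, div_le_iff₀ (by positivity)]
    refine (norm_add_le _ _).trans ?_
    rw [Complex.norm_natCast]
    nlinarith [norm_nonneg α, (k.cast_nonneg : (0 : ℝ) ≤ k),
      mul_nonneg (norm_nonneg α) (k.cast_nonneg : (0 : ℝ) ≤ k)]
  have h2 : 2 * (‖α‖ + 1) * ‖z‖ + 1 ≤ ‖β + k‖ := by
    have := norm_sub_le (β + k) β
    rw [add_sub_cancel_left, Complex.norm_natCast] at this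
    linarith
  have h3 : ‖z / (β + k)‖ ≤ 1 / (2 * (‖α‖ + 1)) := by
    have : 0 < ‖β + k‖ := lt_of_lt_of_le (by positivity) h2
    rw [norm_div, div_le_div_iff₀ this (by positivity)]
    linarith
  calc _ ≤ (‖α‖ + 1) * (1 / (2 * (‖α‖ + 1))) := by gcongr
    _ = 1 / 2 := by field_simp

lemma ascPochhammer_half (k : ℕ) :
    (ascPochhammer ℂ k).eval (3 / 2) = (2 * k + 1) * (ascPochhammer ℂ k).eval (1 / 2) := by
  have h1 := ascPochhammer_eval_succ_left (1 / 2) k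
  have h2 := ascPochhammer_succ_eval k (1 / 2 : ℂ)
  norm_num at h1 h2 ⊢
  linear_combination 2 * h2 - 2 * h1

/-- The contiguous relation behind the even part (in `x`) of the Hermite recurrence. -/
lemma kummerM_sub (α y : ℂ) :
    kummerM α (1 / 2) y - kummerM (α - 1) (1 / 2) y = 2 * y * kummerM α (3 / 2) y := by
  unfold kummerM
  rw [← (summable_kummerM _ _ _).tsum_sub (summable_kummerM _ _ _),
    ((summable_kummerM _ _ _).sub (summable_kummerM _ _ _)).tsum_eq_zero_add, ← tsum_mul_left]
  simp only [ascPochhammer_zero, Polynomial.eval_one, sub_self, zero_add]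
  refine tsum_congr fun k => ?_
  have hβ := ascPochhammer_eval_ne_zero (β := 1 / 2) (by norm_num) k
  have hk : (k.factorial : ℂ) ≠ 0 := by exact_mod_cast k.factorial_ne_zero
  have hk1 : (2 * k + 1 : ℂ) ≠ 0 := by exact_mod_cast (by omega : 2 * k + 1 ≠ 0)
  have hk3 : (k + 1 : ℂ) ≠ 0 := by exact_mod_cast (by omega : k + 1 ≠ 0)
  rw [ascPochhammer_eval_succ_left (α - 1), ascPochhammer_succ_eval, sub_add_cancel,
    ascPochhammer_succ_eval k (1 / 2 : ℂ), ascPochhammer_half, Nat.factorial_succ,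
    show (1 / 2 + k : ℂ) = (2 * k + 1) / 2 by ring]
  push_cast
  field_simp
  ring

/-- The contiguous relation behind the odd part (in `x`) of the Hermite recurrence. -/
lemma kummerM_three_half (β y : ℂ) :
    (1 - 2 * β) * kummerM β (3 / 2) y + 2 * β * kummerM (β + 1) (3 / 2) y =
      kummerM β (1 / 2) y := by
  unfold kummerM
  rw [← tsum_mul_left, ← tsum_mul_left, ← ((summable_kummerM _ _ _).mul_left _).tsum_add
    ((summable_kummerM _ _ _).mul_left _)]
  refine tsum_congr fun k => ?_
  have hβ := ascPochhammer_eval_ne_zero (β := 1 / 2) (by norm_num) k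
  have hk : (k.factorial : ℂ) ≠ 0 := by exact_mod_cast k.factorial_ne_zero
  have hk1 : (2 * k + 1 : ℂ) ≠ 0 := by exact_mod_cast (by omega : 2 * k + 1 ≠ 0)
  have h1 := ascPochhammer_eval_succ_left β k
  rw [ascPochhammer_succ_eval] at h1
  rw [ascPochhammer_half]
  field_simp
  linear_combination (-2) * y ^ k * h1

lemma hermiteFn_add_one (ν x : ℂ) :
    hermiteFn (ν + 1) x = 2 * x * hermiteFn ν x - 2 * ν * hermiteFn (ν - 1) x := by
  have two : (2 : ℂ) ≠ 0 := two_ne_zero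
  have g1 := Complex.one_div_Gamma_eq_self_mul_one_div_Gamma_add_one (-(ν + 1) / 2)
  have g2 := Complex.one_div_Gamma_eq_self_mul_one_div_Gamma_add_one (-ν / 2)
  have hE := kummerM_sub ((1 - ν) / 2) (x ^ 2)
  have hO := kummerM_three_half (-ν / 2) (x ^ 2)
  unfold hermiteFn
  rw [Complex.cpow_add _ _ two, Complex.cpow_sub _ _ two, Complex.cpow_one]
  rw [show -(ν + 1) / 2 + 1 = (1 - ν) / 2 by ring] at g1
  rw [show -ν / 2 + 1 = (1 - (ν - 1)) / 2 by ring] at g2 hO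
  rw [show (1 - ν) / 2 - 1 = -(ν + 1) / 2 by ring] at hE
  rw [show (1 - (ν + 1)) / 2 = -ν / 2 by ring, show -(ν - 1) / 2 = (1 - ν) / 2 by ring]
  simp only [← one_div] at g1 g2 ⊢
  rw [g1]
  generalize kummerM ((1 - ν) / 2) (1 / 2) (x ^ 2) = A at *
  generalize kummerM ((1 - ν) / 2) (3 / 2) (x ^ 2) = A3 at *
  generalize kummerM (-(ν + 1) / 2) (1 / 2) (x ^ 2) = B at *
  generalize kummerM (-ν / 2) (1 / 2) (x ^ 2) = C at *
  generalize kummerM (-ν / 2) (3 / 2) (x ^ 2) = C3 at *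
  generalize kummerM ((1 - (ν - 1)) / 2) (3 / 2) (x ^ 2) = D at *
  generalize 1 / Complex.Gamma ((1 - (ν - 1)) / 2) = G at *
  generalize 1 / Complex.Gamma ((1 - ν) / 2) = G' at *
  generalize 1 / Complex.Gamma (-ν / 2) = G'' at *
  generalize (2 : ℂ) ^ ν = T
  subst g2
  linear_combination (T * √Real.pi * ν * G) * hE + 2 * x * T * √Real.pi * G' * hO

/-! ### Comparison of the integrands -/

lemma log_one_add_le {u : ℝ} (hu : 0 ≤ u) :
    Real.log (1 + u) ≤ u - u ^ 2 / (2 * (1 + u)) := by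
  have h1 : (0 : ℝ) < 1 + u := by positivity
  have h := Real.self_le_sinh_iff.2 (Real.log_nonneg (by linarith : (1 : ℝ) ≤ 1 + u))
  rw [Real.sinh_eq, Real.exp_neg, Real.exp_log h1] at h
  refine h.trans (le_of_eq ?_)
  field_simp
  ring

lemma sub_sq_le_log_one_add {u : ℝ} (hu : 0 ≤ u) : u - u ^ 2 / 2 ≤ Real.log (1 + u) := by
  refine le_trans ?_ (Real.le_log_one_add_of_nonneg hu)
  rw [le_div_iff₀ (by positivity)]
  nlinarith [pow_nonneg hu 3]

/-- The kernel in the integral representation of `scaledCharlier`. -/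
noncomputable def charlierKernel (b : ℝ) (n : ℕ) (t : ℝ) : ℝ :=
  Real.exp (-(b * t)) * (1 + 2 * t / b) ^ n

/-- The kernel in the integral representation of `hermiteFn`. -/
noncomputable def hermiteKernel (x t : ℝ) : ℝ := Real.exp (-t ^ 2 - 2 * x * t)

/-- Since `n = b² / 2 - b X`, the exponent is `(b² / 2) (log (1 + u) - u) - b X log (1 + u)` with
`u = 2t / b`, which tends to `-t² - 2Xt`. -/
lemma charlierKernel_eq_exp {b : ℝ} (hb : 0 < b) (n : ℕ) {t : ℝ} (ht : 0 ≤ t) :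
    charlierKernel b n t = Real.exp (b ^ 2 / 2 * (Real.log (1 + 2 * t / b) - 2 * t / b)
      - b * hermitePoint b n * Real.log (1 + 2 * t / b)) := by
  have h1 : 0 < 1 + 2 * t / b := by positivity
  rw [charlierKernel, ← Real.exp_log h1, ← Real.exp_nat_mul, ← Real.exp_add, Real.exp_log h1,
    hermitePoint]
  congr 1
  field_simp
  ring

lemma charlierKernel_exponent_le {A b X t : ℝ} (hb : 4 * (2 * A + 2) ≤ b) (hX : |X| ≤ A)
    (ht : 0 ≤ t) :
    b ^ 2 / 2 * (Real.log (1 + 2 * t / b) - 2 * t / b) - b * X * Real.log (1 + 2 * t / b) ≤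
      (2 * A + 2) ^ 2 / 2 - 2 * t := by
  have hA : 0 ≤ A := (abs_nonneg X).trans hX
  have hb0 : 0 < b := by linarith
  set u := 2 * t / b with hu
  have hu0 : 0 ≤ u := by positivity
  have htu : b * u = 2 * t := by rw [hu]; field_simp
  have hlog0 : 0 ≤ Real.log (1 + u) := Real.log_nonneg (by linarith)
  have hlog := log_one_add_le hu0
  have hlog1 : Real.log (1 + u) ≤ u := hlog.trans (by
    have : 0 ≤ u ^ 2 / (2 * (1 + u)) := by positivity
    linarith)
  have e1 : -(b * X * Real.log (1 + u)) ≤ 2 * A * t := by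
    have : -X ≤ A := by linarith [neg_abs_le X]
    calc -(b * X * Real.log (1 + u)) = (-X) * (b * Real.log (1 + u)) := by ring
      _ ≤ A * (b * Real.log (1 + u)) := by gcongr
      _ ≤ A * (b * u) := by gcongr
      _ = 2 * A * t := by rw [htu]; ring
  have e2 : b ^ 2 / 2 * (Real.log (1 + u) - u) ≤ -(t ^ 2 / (1 + u)) := by
    calc b ^ 2 / 2 * (Real.log (1 + u) - u) ≤ b ^ 2 / 2 * (-(u ^ 2 / (2 * (1 + u)))) := by
          gcongr; linarith
      _ = -((b * u) ^ 2 / (4 * (1 + u))) := by field_simp; ring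
      _ = _ := by rw [htu]; field_simp; ring
  -- For large `t` the quotient `t² / (1 + u)` grows only linearly, with slope `b / 2`; the lower
  -- bound on `b` makes this slope exceed `2A + 2`.
  have e3 : (2 * A + 2) * t - (2 * A + 2) ^ 2 / 2 ≤ t ^ 2 / (1 + u) := by
    rw [le_div_iff₀ (by positivity)]
    have : (2 * A + 2) * (4 * u) ≤ 2 * t := by
      calc (2 * A + 2) * (4 * u) = (4 * (2 * A + 2)) * u := by ring
        _ ≤ b * u := by gcongr
        _ = 2 * t := htu
    nlinarith [sq_nonneg (t - (2 * A + 2)), mul_nonneg (sq_nonneg (2 * A + 2)) hu0,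
      mul_le_mul_of_nonneg_right this ht]
  linarith

lemma charlierKernel_le {A b : ℝ} {n : ℕ} {t : ℝ} (hb : 4 * (2 * A + 2) ≤ b)
    (hX : |hermitePoint b n| ≤ A) (ht : 0 ≤ t) :
    charlierKernel b n t ≤ Real.exp ((2 * A + 2) ^ 2 / 2) * Real.exp (-(2 * t)) := by
  have hA : 0 ≤ A := (abs_nonneg _).trans hX
  rw [charlierKernel_eq_exp (by linarith) n ht, ← Real.exp_add, Real.exp_le_exp, ← sub_eq_add_neg]
  exact charlierKernel_exponent_le hb hX ht

lemma hermiteKernel_exponent_le {A x t : ℝ} (hx : |x| ≤ A) (ht : 0 ≤ t) :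
    -t ^ 2 - 2 * x * t ≤ (2 * A + 2) ^ 2 / 2 - 2 * t := by
  have : -x ≤ A := by linarith [neg_abs_le x]
  nlinarith [sq_nonneg (t - (A + 1)), mul_le_mul_of_nonneg_right this ht, sq_nonneg (A + 1)]

lemma hermiteKernel_le {A x t : ℝ} (hx : |x| ≤ A) (ht : 0 ≤ t) :
    hermiteKernel x t ≤ Real.exp ((2 * A + 2) ^ 2 / 2) * Real.exp (-(2 * t)) := by
  rw [hermiteKernel, ← Real.exp_add, Real.exp_le_exp, ← sub_eq_add_neg]
  exact hermiteKernel_exponent_le hx ht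

lemma abs_exp_sub_exp_le {p q M : ℝ} (hp : p ≤ M) (hq : q ≤ M) :
    |Real.exp p - Real.exp q| ≤ Real.exp M * |p - q| := by
  wlog h : q ≤ p generalizing p q
  · rw [abs_sub_comm, abs_sub_comm p]
    exact this hq hp (le_of_not_ge h)
  rw [abs_of_nonneg (sub_nonneg.2 (Real.exp_le_exp.2 h)), abs_of_nonneg (sub_nonneg.2 h)]
  have h1 := Real.add_one_le_exp (q - p)
  rw [Real.exp_sub, le_div_iff₀ (Real.exp_pos p)] at h1
  have h2 : Real.exp p * (p - q) ≤ Real.exp M * (p - q) :=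
    mul_le_mul_of_nonneg_right (Real.exp_le_exp.2 hp) (sub_nonneg.2 h)
  linarith

lemma abs_charlierKernel_sub_le {A b x : ℝ} {n : ℕ} {t : ℝ} (hb : 4 * (2 * A + 2) ≤ b)
    (hX : |hermitePoint b n| ≤ A) (hx : |x| ≤ A) (ht : 0 ≤ t) :
    |charlierKernel b n t - hermiteKernel x t| ≤
      Real.exp ((2 * A + 2) ^ 2 / 2) * (4 * A + 12) * (1 / b + |hermitePoint b n - x|) *
        Real.exp (-t) := by
  have hA : 0 ≤ A := (abs_nonneg _).trans hX
  have hb0 : 0 < b := by linarith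
  have h1 := charlierKernel_exponent_le hb hX ht
  have h2 := hermiteKernel_exponent_le hx ht
  rw [charlierKernel_eq_exp hb0 n ht, hermiteKernel]
  refine (abs_exp_sub_exp_le h1 h2).trans ?_
  set X := hermitePoint b n
  set u := 2 * t / b with hu
  have hu0 : 0 ≤ u := by positivity
  have htu : t = b * u / 2 := by rw [hu]; field_simp
  have l1 := log_one_add_le hu0
  have l2 := sub_sq_le_log_one_add hu0
  have l3 : u ^ 2 / 2 - u ^ 3 / 2 ≤ u ^ 2 / (2 * (1 + u)) := by
    rw [le_div_iff₀ (by positivity)]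
    nlinarith [pow_nonneg hu0 4]
  have l4 : 0 ≤ u ^ 2 / (2 * (1 + u)) := by positivity
  have d1 : |b ^ 2 / 2 * (Real.log (1 + u) - u + u ^ 2 / 2)| ≤ 2 * t ^ 3 / b := by
    rw [abs_mul, abs_of_nonneg (by positivity : 0 ≤ b ^ 2 / 2)]
    calc _ ≤ b ^ 2 / 2 * (u ^ 3 / 2) := by
          gcongr
          rw [abs_le]
          constructor
          · nlinarith [pow_nonneg hu0 3]
          · linarith
      _ = _ := by rw [htu]; field_simp
  have d2 : |b * X * (Real.log (1 + u) - u)| ≤ 2 * A * t ^ 2 / b := by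
    rw [abs_mul, abs_mul, abs_of_pos hb0]
    calc _ ≤ b * A * (u ^ 2 / 2) := by
          gcongr
          rw [abs_le]
          constructor <;> linarith
      _ = _ := by rw [htu]; field_simp
  have d3 : |2 * (X - x) * t| = 2 * |X - x| * t := by
    rw [abs_mul, abs_mul, abs_of_nonneg ht, abs_two]
  have e : b ^ 2 / 2 * (Real.log (1 + u) - u) - b * X * Real.log (1 + u) - (-t ^ 2 - 2 * x * t) =
      b ^ 2 / 2 * (Real.log (1 + u) - u + u ^ 2 / 2) - b * X * (Real.log (1 + u) - u)
        - 2 * (X - x) * t := by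
    rw [htu]; ring
  have p1 : t ≤ Real.exp t := by simpa using Real.pow_div_factorial_le_exp t ht 1
  have p2 : t ^ 2 / 2 ≤ Real.exp t := by
    simpa [Nat.factorial] using Real.pow_div_factorial_le_exp t ht 2
  have p3 : t ^ 3 / 6 ≤ Real.exp t := by
    simpa [Nat.factorial] using Real.pow_div_factorial_le_exp t ht 3
  have hb1 : 0 ≤ 1 / b := by positivity
  have habs := abs_nonneg (X - x)
  have tot : |b ^ 2 / 2 * (Real.log (1 + u) - u) - b * X * Real.log (1 + u)
      - (-t ^ 2 - 2 * x * t)| ≤ (4 * A + 12) * (1 / b + |X - x|) * Real.exp t := by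
    rw [e]
    refine (abs_sub _ _).trans ((add_le_add_left (abs_sub _ _) _).trans ?_)
    calc _ ≤ 2 * t ^ 3 / b + 2 * A * t ^ 2 / b + 2 * |X - x| * t := by
          rw [d3]; gcongr
      _ = (1 / b) * (12 * (t ^ 3 / 6) + 4 * A * (t ^ 2 / 2)) + |X - x| * (2 * t) := by ring
      _ ≤ (1 / b) * ((4 * A + 12) * Real.exp t) + |X - x| * ((4 * A + 12) * Real.exp t) := by
          gcongr
          · nlinarith [mul_le_mul_of_nonneg_left p2 hA]
          · nlinarith [mul_nonneg hA (Real.exp_pos t).le]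
      _ = _ := by ring
  calc _ ≤ Real.exp ((2 * A + 2) ^ 2 / 2 - 2 * t) *
        ((4 * A + 12) * (1 / b + |X - x|) * Real.exp t) := by gcongr
    _ = _ := by
      have : Real.exp (-t) = Real.exp (-2 * t) * Real.exp t := by rw [← Real.exp_add]; ring_nf
      rw [this, sub_eq_add_neg, Real.exp_add, ← neg_mul]
      ring

/-! ### Integral representations -/

lemma mellinConvergent_of_norm_le_exp {f : ℝ → ℂ} (hf : Continuous f) {C : ℝ}
    (hC : ∀ t, 0 < t → ‖f t‖ ≤ C * Real.exp (-t)) {s : ℂ} (hs : 0 < s.re) :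
    MellinConvergent f s := by
  refine MeasureTheory.Integrable.mono' ((Complex.GammaIntegral_convergent hs).norm.const_mul C)
    ?_ ?_
  · refine ContinuousOn.aestronglyMeasurable ?_ measurableSet_Ioi
    refine ContinuousOn.smul (f := fun t : ℝ => (t : ℂ) ^ (s - 1)) (fun t ht => ?_) hf.continuousOn
    exact (Complex.continuousAt_ofReal_cpow_const t (s - 1)
      (Or.inr (ne_of_gt ht))).continuousWithinAt
  · refine (MeasureTheory.ae_restrict_iff' measurableSet_Ioi).2
      (Eventually.of_forall fun t ht => ?_)
    rw [norm_smul, norm_mul, Complex.norm_real, Real.norm_eq_abs, Real.abs_exp]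
    have := mul_le_mul_of_nonneg_left (hC t ht) (norm_nonneg ((t : ℂ) ^ (s - 1)))
    linarith

lemma hermiteKernel_pos (x t : ℝ) : 0 < hermiteKernel x t := Real.exp_pos _

lemma continuous_hermiteKernel (x : ℝ) : Continuous (hermiteKernel x) := by
  unfold hermiteKernel
  fun_prop

lemma mellinConvergent_hermiteKernel (x : ℝ) {s : ℂ} (hs : 0 < s.re) :
    MellinConvergent (fun t => (hermiteKernel x t : ℂ)) s := by
  refine mellinConvergent_of_norm_le_exp
    (Complex.continuous_ofReal.comp (continuous_hermiteKernel x))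
    (C := Real.exp ((2 * |x| + 2) ^ 2 / 2)) (fun t ht => ?_) hs
  rw [Function.comp_apply, Complex.norm_real, Real.norm_eq_abs, abs_of_pos (hermiteKernel_pos _ _)]
  refine (hermiteKernel_le le_rfl ht.le).trans ?_
  gcongr
  linarith

lemma hasMellin_charlierKernel {b : ℝ} (hb : 0 < b) (n : ℕ) {z : ℂ} (hz : z.re < 0) :
    HasMellin (fun t => (charlierKernel b n t : ℂ)) (-z)
      (Complex.Gamma (-z) * scaledCharlier b n z) := by
  have hb' : (b : ℂ) ≠ 0 := by exact_mod_cast hb.ne'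
  induction n generalizing z with
  | zero =>
    have hs : 0 < (-z).re := by simpa using hz
    have e : mellin (fun t => (charlierKernel b 0 t : ℂ)) (-z) =
        Complex.Gamma (-z) * scaledCharlier b 0 z := by
      have h := Complex.integral_cpow_mul_exp_neg_mul_Ioi hs hb
      rw [scaledCharlier_zero, mul_comm, mellin]
      have hinv : (1 / (b : ℂ)) ^ (-z) = (b : ℂ) ^ z := by
        rw [one_div, Complex.inv_cpow, Complex.cpow_neg, inv_inv]
        rw [Complex.arg_ofReal_of_nonneg hb.le]
        exact Real.pi_pos.ne
      rw [← hinv, ← h]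
      simp [charlierKernel]
    refine ⟨?_, e⟩
    by_contra hn
    have h0 : mellin (fun t => (charlierKernel b 0 t : ℂ)) (-z) = 0 :=
      MeasureTheory.integral_undef hn
    rw [h0, scaledCharlier_zero] at e
    exact mul_ne_zero (Complex.Gamma_ne_zero_of_re_pos hs) (by simp [Complex.cpow_eq_zero_iff, hb'])
      e.symm
  | succ n ih =>
    have h1 := ih hz
    have h2 := ih (z := z - 1) (by simp; linarith)
    have h3 : HasMellin (fun t : ℝ => (t : ℂ) ^ (1 : ℂ) • (charlierKernel b n t : ℂ)) (-z)
        (Complex.Gamma (-(z - 1)) * scaledCharlier b n (z - 1)) := by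
      rw [show -(z - 1) = -z + 1 by ring] at h2 ⊢
      exact ⟨MellinConvergent.cpow_smul.2 h2.1, by rw [mellin_cpow_smul]; exact h2.2⟩
    have h4 := hasMellin_const_smul h3.1 (2 / b : ℂ)
    have h5 := hasMellin_add h1.1 h4.1
    have hfun : (fun t => (charlierKernel b (n + 1) t : ℂ)) = fun t : ℝ =>
        (charlierKernel b n t : ℂ) + (2 / b : ℂ) • (t : ℂ) ^ (1 : ℂ) • (charlierKernel b n t : ℂ) := by
      funext t
      simp only [charlierKernel, Complex.cpow_one, smul_eq_mul, pow_succ]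
      push_cast
      ring
    rw [hfun]
    refine ⟨h5.1, h5.2.trans ?_⟩
    have hG := Complex.Gamma_add_one (-z) (by intro h; rw [neg_eq_zero] at h; simp [h] at hz)
    rw [h1.2, h4.2, h3.2, scaledCharlier_succ hb, show -(z - 1) = -z + 1 by ring, hG, smul_eq_mul]
    field_simp
    ring

lemma mellin_exp_neg_sq {s : ℂ} (hs : 0 < s.re) :
    mellin (fun t => (Real.exp (-t ^ 2) : ℂ)) s = Complex.Gamma (s / 2) / 2 := by
  have h := mellin_comp_rpow (fun t => (Real.exp (-t) : ℂ)) s 2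
  have hs2 : 0 < (s / 2).re := by simpa using hs
  simp only [Real.rpow_two] at h
  rw [h, Complex.Gamma_eq_integral hs2, Complex.GammaIntegral_eq_mellin]
  simp
  ring

lemma Gamma_add_natCast {s : ℂ} (hs : 0 < s.re) (k : ℕ) :
    Complex.Gamma (s + k) = (ascPochhammer ℂ k).eval s * Complex.Gamma s := by
  induction k with
  | zero => simp
  | succ k ih =>
    have : s + k ≠ 0 := fun h => by
      have := congrArg Complex.re h
      simp at this
      have hk : (0 : ℝ) ≤ k := k.cast_nonneg
      linarith
    push_cast
    rw [← add_assoc, Complex.Gamma_add_one _ this, ih, ascPochhammer_succ_eval]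
    ring

lemma factorial_two_mul (k : ℕ) :
    ((2 * k).factorial : ℂ) = 4 ^ k * k.factorial * (ascPochhammer ℂ k).eval (1 / 2) := by
  induction k with
  | zero => simp
  | succ k ih =>
    rw [show 2 * (k + 1) = 2 * k + 1 + 1 by ring, Nat.factorial_succ, Nat.factorial_succ,
      Nat.factorial_succ, ascPochhammer_succ_eval]
    push_cast
    rw [ih]
    ring

lemma hasSum_mellin_hermiteKernel (x : ℝ) {s : ℂ} (hs : 0 < s.re) :
    HasSum (fun k : ℕ => (-2 * x : ℂ) ^ k / k.factorial * (Complex.Gamma ((s + k) / 2) / 2))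
      (mellin (fun t => (hermiteKernel x t : ℂ)) s) := by
  have hterm (k : ℕ) : ∫ t : ℝ in Set.Ioi 0, (t : ℂ) ^ (s - 1) *
      ((Real.exp (-t ^ 2) : ℂ) * ((-2 * x * t : ℂ) ^ k / k.factorial)) =
      (-2 * x : ℂ) ^ k / k.factorial * (Complex.Gamma ((s + k) / 2) / 2) := by
    have hsk : 0 < (s + k).re := by
      simp only [Complex.add_re, Complex.natCast_re]; positivity
    rw [← mellin_exp_neg_sq hsk, mellin, ← MeasureTheory.integral_const_mul]
    refine MeasureTheory.setIntegral_congr_fun measurableSet_Ioi fun t ht => ?_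
    have ht' : (t : ℂ) ≠ 0 := by exact_mod_cast (ne_of_gt ht)
    simp only [smul_eq_mul]
    rw [show s + k - 1 = s - 1 + k by ring, Complex.cpow_add _ _ ht', Complex.cpow_natCast, mul_pow]
    ring
  simp_rw [← hterm]
  have hexp (y : ℝ) : HasSum (fun k : ℕ => y ^ k / k.factorial) (Real.exp y) := by
    rw [Real.exp_eq_exp_ℝ]
    exact NormedSpace.expSeries_div_hasSum_exp y
  have hbound (t : ℝ) : HasSum (fun k : ℕ => ‖(t : ℂ) ^ (s - 1)‖ *
      (Real.exp (-t ^ 2) * ((2 * |x| * t) ^ k / k.factorial)))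
      (‖(t : ℂ) ^ (s - 1)‖ * hermiteKernel (-|x|) t) := by
    have := ((hexp (2 * |x| * t)).mul_left (Real.exp (-t ^ 2))).mul_left ‖(t : ℂ) ^ (s - 1)‖
    rw [← Real.exp_add] at this
    rwa [show hermiteKernel (-|x|) t = Real.exp (-t ^ 2 + 2 * |x| * t) by
      rw [hermiteKernel]; congr 1; ring]
  have hconv := (mellinConvergent_hermiteKernel (-|x|) hs).norm
  refine MeasureTheory.hasSum_integral_of_dominated_convergence
    (fun k t => ‖(t : ℂ) ^ (s - 1)‖ *
      (Real.exp (-t ^ 2) * ((2 * |x| * t) ^ k / k.factorial))) (fun k => ?_) (fun k => ?_) ?_ ?_ ?_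
  · refine ContinuousOn.aestronglyMeasurable ?_ measurableSet_Ioi
    refine ContinuousOn.mul (fun t ht => ?_) (by fun_prop)
    exact (Complex.continuousAt_ofReal_cpow_const t (s - 1)
      (Or.inr (ne_of_gt ht))).continuousWithinAt
  · refine (MeasureTheory.ae_restrict_iff' measurableSet_Ioi).2
      (Eventually.of_forall fun t ht => ?_)
    have ht' : 0 < t := ht
    rw [norm_mul, norm_mul, Complex.norm_real, Real.norm_eq_abs, Real.abs_exp]
    simp [abs_of_pos ht']
  · exact Eventually.of_forall fun t => (hbound t).summable
  · refine hconv.congr ((MeasureTheory.ae_restrict_iff' measurableSet_Ioi).2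
      (Eventually.of_forall fun t ht => ?_))
    dsimp only
    rw [(hbound t).tsum_eq, norm_smul, Complex.norm_real, Real.norm_eq_abs,
      abs_of_pos (hermiteKernel_pos _ _)]
  · refine Eventually.of_forall fun t => ?_
    have h1 : HasSum (fun k : ℕ => (-2 * x * t : ℂ) ^ k / k.factorial) (Real.exp (-2 * x * t)) := by
      have := hexp (-2 * x * t)
      rw [← Complex.hasSum_ofReal] at this
      push_cast at this ⊢
      exact this
    have := (h1.mul_left (Real.exp (-t ^ 2) : ℂ)).mul_left ((t : ℂ) ^ (s - 1))
    rw [← Complex.ofReal_mul, ← Real.exp_add] at this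
    dsimp only
    rwa [smul_eq_mul, show hermiteKernel x t = Real.exp (-t ^ 2 + -2 * x * t) by
      rw [hermiteKernel]; congr 1; ring]

lemma hasSum_even_hermite (x : ℝ) {s : ℂ} (hs : 0 < (s / 2).re) :
    HasSum (fun k : ℕ => (-2 * x : ℂ) ^ (2 * k) / (2 * k).factorial *
      (Complex.Gamma ((s + (2 * k : ℕ)) / 2) / 2))
      (Complex.Gamma (s / 2) / 2 * kummerM (s / 2) (1 / 2) ((x : ℂ) ^ 2)) := by
  have h := ((summable_kummerM (s / 2) (1 / 2) ((x : ℂ) ^ 2)).hasSum.mul_left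
    (Complex.Gamma (s / 2) / 2))
  refine Eq.subst (motive := fun f => HasSum f _) (funext fun k => ?_) h
  symm
  have hβ := ascPochhammer_eval_ne_zero (β := 1 / 2) (by norm_num) k
  have hk : (k.factorial : ℂ) ≠ 0 := by exact_mod_cast k.factorial_ne_zero
  rw [show (s + (2 * k : ℕ)) / 2 = s / 2 + k by push_cast; ring, Gamma_add_natCast hs,
    factorial_two_mul, pow_mul, show (-2 * x : ℂ) ^ 2 = 4 * x ^ 2 by ring, mul_pow]
  field_simp

lemma hasSum_odd_hermite (x : ℝ) {s : ℂ} (hs : 0 < ((s + 1) / 2).re) :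
    HasSum (fun k : ℕ => (-2 * x : ℂ) ^ (2 * k + 1) / (2 * k + 1).factorial *
      (Complex.Gamma ((s + (2 * k + 1 : ℕ)) / 2) / 2))
      (-x * Complex.Gamma ((s + 1) / 2) * kummerM ((s + 1) / 2) (3 / 2) ((x : ℂ) ^ 2)) := by
  have h := ((summable_kummerM ((s + 1) / 2) (3 / 2) ((x : ℂ) ^ 2)).hasSum.mul_left
    (-x * Complex.Gamma ((s + 1) / 2)))
  refine Eq.subst (motive := fun f => HasSum f _) (funext fun k => ?_) h
  symm
  have hβ := ascPochhammer_eval_ne_zero (β := 1 / 2) (by norm_num) k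
  have hk : (k.factorial : ℂ) ≠ 0 := by exact_mod_cast k.factorial_ne_zero
  have hk1 : (2 * k + 1 : ℂ) ≠ 0 := by exact_mod_cast (by omega : 2 * k + 1 ≠ 0)
  rw [show (s + (2 * k + 1 : ℕ)) / 2 = (s + 1) / 2 + k by push_cast; ring,
    Gamma_add_natCast hs, Nat.factorial_succ, Nat.cast_mul,
    factorial_two_mul, pow_succ, pow_mul, show (-2 * x : ℂ) ^ 2 = 4 * x ^ 2 by ring, mul_pow,
    ascPochhammer_half]
  push_cast
  field_simp

lemma Gamma_mul_hermiteFn (x : ℂ) {ν : ℂ} (hν : ν.re < 0) :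
    Complex.Gamma (-ν) * hermiteFn ν x =
      Complex.Gamma (-ν / 2) / 2 * kummerM (-ν / 2) (1 / 2) (x ^ 2) +
        -x * Complex.Gamma ((1 - ν) / 2) * kummerM ((1 - ν) / 2) (3 / 2) (x ^ 2) := by
  have h0 : 0 < (-ν / 2).re := by simpa using hν
  have h1 : 0 < ((1 - ν) / 2).re := by simp at hν ⊢; linarith
  have dup := Complex.Gamma_mul_Gamma_add_half (-ν / 2)
  rw [show -ν / 2 + 1 / 2 = (1 - ν) / 2 by ring, show 2 * (-ν / 2) = -ν by ring,
    show (1 : ℂ) - -ν = 1 + ν by ring, Complex.cpow_add _ _ two_ne_zero, Complex.cpow_one] at dup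
  have g0 := Complex.Gamma_ne_zero_of_re_pos h0
  have g1 := Complex.Gamma_ne_zero_of_re_pos h1
  unfold hermiteFn
  generalize kummerM (-ν / 2) (1 / 2) (x ^ 2) = A
  generalize kummerM ((1 - ν) / 2) (3 / 2) (x ^ 2) = B
  generalize Complex.Gamma (-ν / 2) = G0 at *
  generalize Complex.Gamma ((1 - ν) / 2) = G1 at *
  generalize Complex.Gamma (-ν) = G at *
  generalize (2 : ℂ) ^ ν = T at *
  generalize (√Real.pi : ℂ) = S at *
  have e : G * (T * S * (G1⁻¹ * A - 2 * x * G0⁻¹ * B)) =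
      (G * (2 * T) * S) * (G1⁻¹ * A - 2 * x * G0⁻¹ * B) / 2 := by ring
  rw [e, ← dup]
  field_simp
  ring

/-- Expanding `exp (-2 x t)` under the integral sign, the even and the odd terms give the two
Kummer functions in the definition of `hermiteFn`. -/
lemma hasMellin_hermiteKernel (x : ℝ) {ν : ℂ} (hν : ν.re < 0) :
    HasMellin (fun t => (hermiteKernel x t : ℂ)) (-ν) (Complex.Gamma (-ν) * hermiteFn ν x) := by
  have hs : 0 < (-ν).re := by simpa using hν
  have h0 : 0 < (-ν / 2).re := by simpa using hν
  have h1 : 0 < ((-ν + 1) / 2).re := by simp at hν ⊢; linarith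
  refine ⟨mellinConvergent_hermiteKernel x hs, ?_⟩
  rw [Gamma_mul_hermiteFn _ hν, show 1 - ν = -ν + 1 by ring]
  exact (hasSum_mellin_hermiteKernel x hs).unique
    ((hasSum_even_hermite x h0).even_add_odd (hasSum_odd_hermite x h1))

/-! ### Convergence of scaled Charlier polynomials to Hermite functions -/

lemma norm_mellin_le_of_norm_le_exp {f : ℝ → ℂ} {C : ℝ}
    (hC : ∀ t, 0 < t → ‖f t‖ ≤ C * Real.exp (-t)) {s : ℂ} (hs : 0 < s.re) :
    ‖mellin f s‖ ≤ C * Real.Gamma s.re := by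
  rw [Real.Gamma_eq_integral hs, ← MeasureTheory.integral_const_mul]
  refine MeasureTheory.norm_integral_le_of_norm_le
    ((Real.GammaIntegral_convergent hs).const_mul C) ?_
  refine (MeasureTheory.ae_restrict_iff' measurableSet_Ioi).2 (Eventually.of_forall fun t ht => ?_)
  rw [norm_smul, Complex.norm_cpow_eq_rpow_re_of_pos ht, Complex.sub_re, Complex.one_re]
  have := mul_le_mul_of_nonneg_left (hC t ht) (Real.rpow_nonneg (le_of_lt ht) (s.re - 1))
  linarith

/-- The scaled Charlier polynomials are bounded on `K` and approximate the Hermite functions there,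
uniformly over all degrees `n` and points `x` in the range given by `A`. The error consists of a
part `1 / b` and a part for the distance of `x` from `hermitePoint b n`. -/
def ConvergesOn (A : ℝ) (K : Set ℂ) : Prop :=
  ∃ M : ℝ, 0 ≤ M ∧ ∀ b : ℝ, 4 * (2 * A + 2) ≤ b → ∀ (n : ℕ) (x : ℝ), |hermitePoint b n| ≤ A →
    |x| ≤ A → ∀ z ∈ K, ‖scaledCharlier b n z‖ ≤ M ∧
      ‖scaledCharlier b n z - hermiteFn z x‖ ≤ M * (1 / b + |hermitePoint b n - x|)

lemma convergesOn_of_re_neg (A : ℝ) {K : Set ℂ} (hK : IsCompact K) (hre : ∀ z ∈ K, z.re < 0) :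
    ConvergesOn A K := by
  have hcont : ContinuousOn (fun z : ℂ => ‖(Complex.Gamma (-z))⁻¹‖ * Real.Gamma (-z.re)) K := by
    refine ContinuousOn.mul ?_ ?_
    · exact (Complex.differentiable_one_div_Gamma.continuous.comp continuous_neg).norm.continuousOn
    · intro z hz
      have hz' : 0 < -z.re := by linarith [hre z hz]
      have h1 : ContinuousAt Real.Gamma (-z.re) :=
        (Real.differentiableAt_Gamma fun m => ne_of_gt
        (lt_of_le_of_lt (neg_nonpos.2 m.cast_nonneg) hz')).continuousAt
      exact (ContinuousAt.comp (f := fun w : ℂ => -w.re) h1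
        (by fun_prop)).continuousWithinAt
  obtain ⟨B, hB⟩ := hK.bddAbove_image hcont
  set C := Real.exp ((2 * A + 2) ^ 2 / 2) with hCdef
  have hC : 0 < C := Real.exp_pos _
  refine ⟨C * (4 * |A| + 12) * |B|, by positivity, fun b hb n x hX hx z hz => ?_⟩
  have hA : 0 ≤ A := (abs_nonneg _).trans hx
  have hb0 : 0 < b := by linarith
  have hzr := hre z hz
  have hs : 0 < (-z).re := by simpa using hzr
  have hG := Complex.Gamma_ne_zero_of_re_pos hs
  have hBz : ‖(Complex.Gamma (-z))⁻¹‖ * Real.Gamma (-z).re ≤ |B| :=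
    (hB ⟨z, hz, rfl⟩).trans (le_abs_self B)
  have hF := hasMellin_charlierKernel hb0 n hzr
  have hH := hasMellin_hermiteKernel x hzr
  have hsub := hasMellin_sub hF.1 hH.1
  -- A bound for the Mellin transform turns into one for the quotient by `Γ(-z)`.
  have key {w : ℂ} {D : ℝ} (hD : 0 ≤ D)
      (hw : ‖Complex.Gamma (-z) * w‖ ≤ D * Real.Gamma (-z).re) : ‖w‖ ≤ D * |B| := by
    calc ‖w‖ = ‖(Complex.Gamma (-z))⁻¹‖ * ‖Complex.Gamma (-z) * w‖ := by
          rw [← norm_mul, inv_mul_cancel_left₀ hG]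
      _ ≤ ‖(Complex.Gamma (-z))⁻¹‖ * (D * Real.Gamma (-z).re) := by gcongr
      _ = D * (‖(Complex.Gamma (-z))⁻¹‖ * Real.Gamma (-z).re) := by ring
      _ ≤ D * |B| := by gcongr
  constructor
  · have h1 := norm_mellin_le_of_norm_le_exp (f := fun t => (charlierKernel b n t : ℂ)) (C := C)
      (fun t ht => by
        rw [Complex.norm_real, Real.norm_eq_abs, abs_of_nonneg (by
          unfold charlierKernel; positivity)]
        exact (charlierKernel_le hb hX ht.le).trans (by gcongr; linarith)) hs
    rw [hF.2] at h1
    refine (key hC.le h1).trans ?_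
    gcongr
    nlinarith [abs_nonneg A]
  · set δ := 1 / b + |hermitePoint b n - x| with hδ
    have hδ0 : 0 ≤ δ := by positivity
    have h1 := norm_mellin_le_of_norm_le_exp
      (f := fun t => (charlierKernel b n t : ℂ) - (hermiteKernel x t : ℂ))
      (C := C * (4 * A + 12) * δ)
      (fun t ht => by
        rw [← Complex.ofReal_sub, Complex.norm_real, Real.norm_eq_abs]
        exact abs_charlierKernel_sub_le hb hX hx ht.le) hs
    rw [hsub.2, hF.2, hH.2, ← mul_sub] at h1
    refine (key (by positivity) h1).trans (le_of_eq ?_)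
    rw [abs_of_nonneg hA]
    ring

/-- Scaled Charlier polynomials and Hermite functions satisfy the same recurrence in `z` up to
`O(1 / b)`, so convergence extends one unit to the right. -/
lemma ConvergesOn.of_shift {A : ℝ} {K : Set ℂ} (hK : IsCompact K)
    (h : ConvergesOn A ((fun z => z - 1) '' K ∪ (fun z => z - 2) '' K)) : ConvergesOn A K := by
  obtain ⟨M, hM, h⟩ := h
  obtain ⟨R, hR⟩ := hK.isBounded.exists_norm_le
  refine ⟨(2 * |A| + 2 + 4 * (|R| + 1)) * M, by positivity, fun b hb n x hX hx z hz => ?_⟩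
  have hA : 0 ≤ A := (abs_nonneg _).trans hx
  have hb1 : 1 ≤ b := by linarith
  have hb0 : 0 < b := by linarith
  obtain ⟨f1, g1⟩ := h b hb n x hX hx (z - 1) (Or.inl ⟨z, hz, rfl⟩)
  obtain ⟨f2, g2⟩ := h b hb n x hX hx (z - 2) (Or.inr ⟨z, hz, rfl⟩)
  have hz1 : ‖z - 1‖ ≤ |R| + 1 := by
    refine (norm_sub_le _ _).trans ?_
    rw [norm_one]
    linarith [hR z hz, le_abs_self R]
  have rF := scaledCharlier_add_one hb0 n (z - 1)
  have rH := hermiteFn_add_one (z - 1) x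
  rw [sub_add_cancel, show z - 1 - 1 = z - 2 by ring] at rF rH
  rw [rH, rF]
  generalize scaledCharlier b n (z - 1) = F1 at *
  generalize scaledCharlier b n (z - 2) = F2 at *
  generalize hermiteFn (z - 1) x = H1 at *
  generalize hermiteFn (z - 2) x = H2 at *
  set X := hermitePoint b n
  have hinv : 1 / b ≤ 1 := by rw [div_le_one hb0]; exact hb1
  have nz : ‖2 * (z - 1) / b‖ = 2 * ‖z - 1‖ * (1 / b) := by
    rw [norm_div, norm_mul, Complex.norm_real, Real.norm_eq_abs, abs_of_pos hb0]
    simp; ring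
  have n2 : ‖(2 : ℂ)‖ = 2 := by simp
  rw [abs_of_nonneg hA]
  constructor
  · calc ‖(2 * X + 2 * (z - 1) / b) * F1 - 2 * (z - 1) * F2‖
        ≤ (2 * |X| + 2 * ‖z - 1‖ * (1 / b)) * ‖F1‖ + 2 * ‖z - 1‖ * ‖F2‖ := by
          refine (norm_sub_le _ _).trans ?_
          rw [norm_mul, norm_mul, norm_mul, n2]
          gcongr
          refine (norm_add_le _ _).trans ?_
          rw [nz, norm_mul, n2, Complex.norm_real, Real.norm_eq_abs]
      _ ≤ (2 * A + 2 * (|R| + 1) * 1) * M + 2 * (|R| + 1) * M := by gcongr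
      _ ≤ _ := by nlinarith
  · have e : (2 * X + 2 * (z - 1) / b) * F1 - 2 * (z - 1) * F2
        - (2 * x * H1 - 2 * (z - 1) * H2) =
        2 * ((X - x : ℝ) : ℂ) * F1 + 2 * (z - 1) / b * F1 + 2 * x * (F1 - H1)
          - 2 * (z - 1) * (F2 - H2) := by push_cast; ring
    rw [e]
    set δ := 1 / b + |X - x| with hδ
    have hδ0 : 0 ≤ δ := by positivity
    have d1 : |X - x| ≤ δ := by rw [hδ]; linarith [show 0 ≤ 1 / b by positivity]
    have d2 : 1 / b ≤ δ := by rw [hδ]; linarith [abs_nonneg (X - x)]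
    calc _ ≤ 2 * |X - x| * ‖F1‖ + 2 * ‖z - 1‖ * (1 / b) * ‖F1‖ + 2 * |x| * ‖F1 - H1‖
          + 2 * ‖z - 1‖ * ‖F2 - H2‖ := by
          refine (norm_sub_le _ _).trans (add_le_add ((norm_add_le _ _).trans
            (add_le_add ((norm_add_le _ _).trans (add_le_add ?_ ?_)) ?_)) ?_)
          · rw [norm_mul, norm_mul, n2, Complex.norm_real, Real.norm_eq_abs]
          · rw [norm_mul, nz]
          · rw [norm_mul, norm_mul, n2, Complex.norm_real, Real.norm_eq_abs]
          · rw [norm_mul, norm_mul, n2]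
      _ ≤ 2 * δ * M + 2 * (|R| + 1) * δ * M + 2 * A * (M * δ) + 2 * (|R| + 1) * (M * δ) := by
          gcongr
      _ = _ := by ring

theorem convergesOn_of_isCompact (A : ℝ) {K : Set ℂ} (hK : IsCompact K) : ConvergesOn A K := by
  have main (m : ℕ) : ∀ K : Set ℂ, IsCompact K → (∀ z ∈ K, z.re < m) → ConvergesOn A K := by
    induction m with
    | zero => exact fun K hK h => convergesOn_of_re_neg A hK (by simpa using h)
    | succ m ih =>
      intro K hK h
      refine ConvergesOn.of_shift hK (ih _ ((hK.image (by fun_prop)).union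
        (hK.image (by fun_prop))) ?_)
      rintro _ (⟨z, hz, rfl⟩ | ⟨z, hz, rfl⟩) <;>
      · have := h z hz
        push_cast at this
        simp
        linarith
  obtain ⟨R, hR⟩ := hK.isBounded.exists_norm_le
  obtain ⟨m, hm⟩ := exists_nat_gt R
  exact main m K hK fun z hz => ((Complex.re_le_norm z).trans (hR z hz)).trans_lt hm

/-! ### The Hermite function as a function of its degree -/

lemma abs_hermitePoint_charlierDegree_sub_le (x : ℝ) {b : ℝ} (hb : 0 < b)
    (h : 2 * |x| ≤ b) : |hermitePoint b (charlierDegree x (b ^ 2 / 2)) - x| ≤ 1 / b := by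
  have hsqrt : √(2 * (b ^ 2 / 2)) = b := by
    rw [show 2 * (b ^ 2 / 2) = b ^ 2 by ring, Real.sqrt_sq hb.le]
  have h0 : 0 ≤ b ^ 2 / 2 - x * b := by nlinarith [le_abs_self x]
  rw [charlierDegree, hsqrt, hermitePoint]
  have h1 := Nat.floor_le h0
  have h2 := Nat.lt_floor_add_one (b ^ 2 / 2 - x * b)
  generalize (⌊b ^ 2 / 2 - x * b⌋₊ : ℝ) = n at *
  rw [show (b ^ 2 / 2 - n) / b - x = (b ^ 2 / 2 - x * b - n) / b by field_simp; ring,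
    abs_div, abs_of_pos hb]
  gcongr
  rw [abs_le]
  constructor <;> linarith

/-- Convergence along degrees whose limit point is approached at rate `1 / b`. -/
lemma exists_norm_scaledCharlier_sub_le (x : ℝ) {K : Set ℂ} (hK : IsCompact K) :
    ∃ M : ℝ, 0 < M ∧ ∀ᶠ b in atTop, ∀ n : ℕ, |hermitePoint b n - x| ≤ 2 / b → ∀ z ∈ K,
      ‖scaledCharlier b n z‖ ≤ M ∧ ‖scaledCharlier b n z - hermiteFn z x‖ ≤ M / b := by
  obtain ⟨M, hM, h⟩ := convergesOn_of_isCompact (|x| + 2) hK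
  refine ⟨3 * M + 1, by positivity, ?_⟩
  filter_upwards [eventually_ge_atTop (4 * (2 * (|x| + 2) + 2))] with b hb n hn z hz
  have hx := abs_nonneg x
  have hb1 : 1 ≤ b := by linarith
  have hb0 : 0 < b := by linarith
  have h2 : 2 / b ≤ 2 := div_le_self (by norm_num) hb1
  have hX : |hermitePoint b n| ≤ |x| + 2 := by
    have := abs_sub_abs_le_abs_sub (hermitePoint b n) x
    linarith
  obtain ⟨h3, h4⟩ := h b hb n x hX (by linarith) z hz
  refine ⟨by linarith, h4.trans ?_⟩
  calc M * (1 / b + |hermitePoint b n - x|) ≤ M * (1 / b + 2 / b) := by gcongr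
    _ = (3 * M) / b := by ring
    _ ≤ _ := by gcongr; linarith

lemma eventually_abs_hermitePoint_charlierDegree_sub_le (x : ℝ) :
    ∀ᶠ b in atTop, |hermitePoint b (charlierDegree x (b ^ 2 / 2)) - x| ≤ 1 / b := by
  filter_upwards [eventually_gt_atTop 0, eventually_ge_atTop (2 * |x|)] with b h0 h1
  exact abs_hermitePoint_charlierDegree_sub_le x h0 h1

lemma tendstoLocallyUniformlyOn_scaledCharlier (x : ℝ) :
    TendstoLocallyUniformlyOn (fun b => scaledCharlier b (charlierDegree x (b ^ 2 / 2)))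
      (fun z => hermiteFn z x) atTop Set.univ := by
  rw [tendstoLocallyUniformlyOn_iff_forall_isCompact isOpen_univ]
  intro K _ hK
  obtain ⟨M, hM, h⟩ := exists_norm_scaledCharlier_sub_le x hK
  rw [Metric.tendstoUniformlyOn_iff]
  intro ε hε
  filter_upwards [h, eventually_abs_hermitePoint_charlierDegree_sub_le x, eventually_gt_atTop 0,
    eventually_gt_atTop (M / ε)] with b hb hX h0 hε' z hz
  rw [dist_comm, dist_eq_norm]
  refine (hb _ (hX.trans (by gcongr; norm_num)) z hz).2.trans_lt ?_
  rw [div_lt_iff₀ hε] at hε'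
  rw [div_lt_iff₀ h0]
  linarith

lemma differentiable_hermiteFn (x : ℝ) : Differentiable ℂ fun z => hermiteFn z x := by
  rw [← differentiableOn_univ]
  refine (tendstoLocallyUniformlyOn_scaledCharlier x).differentiableOn ?_ isOpen_univ
  filter_upwards [eventually_gt_atTop 0] with b hb
  exact (differentiable_scaledCharlier hb _).differentiableOn

lemma hermiteFn_ofReal_im (x ν : ℝ) : (hermiteFn (ν : ℂ) x).im = 0 := by
  have h := (tendstoLocallyUniformlyOn_scaledCharlier x).tendsto_at (Set.mem_univ (ν : ℂ))
  have h1 := (Complex.continuous_im.tendsto _).comp h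
  refine tendsto_nhds_unique h1 (tendsto_const_nhds.congr' ?_)
  filter_upwards [eventually_gt_atTop 0] with b hb
  exact (scaledCharlier_ofReal_im hb _ ν).symm

/-! ### Positivity of the Hermite function for large arguments -/

lemma hermiteFn_pos_of_neg (x : ℝ) {ν : ℝ} (hν : ν < 0) :
    ∃ r : ℝ, 0 < r ∧ hermiteFn (ν : ℂ) x = r := by
  have hH := hasMellin_hermiteKernel x (ν := (ν : ℂ)) (by simpa using hν)
  have e : ∀ t ∈ Set.Ioi (0 : ℝ), (t : ℂ) ^ (-(ν : ℂ) - 1) • (hermiteKernel x t : ℂ) =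
      ((t ^ (-ν - 1) * hermiteKernel x t : ℝ) : ℂ) := fun t ht => by
    rw [Complex.ofReal_mul, Complex.ofReal_cpow (le_of_lt ht)]
    push_cast
    rfl
  have hint : MeasureTheory.IntegrableOn (fun t => t ^ (-ν - 1) * hermiteKernel x t)
      (Set.Ioi 0) := by
    have h1 : MeasureTheory.IntegrableOn
      (fun t => ((t ^ (-ν - 1) * hermiteKernel x t : ℝ) : ℂ)) (Set.Ioi 0) :=
      (MeasureTheory.integrableOn_congr_fun e measurableSet_Ioi).1 hH.1
    rw [MeasureTheory.IntegrableOn]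
    simpa using h1.re
  have hpos : 0 < ∫ t in Set.Ioi (0 : ℝ), t ^ (-ν - 1) * hermiteKernel x t := by
    rw [MeasureTheory.setIntegral_pos_iff_support_of_nonneg_ae _ hint]
    · have : Function.support (fun t => t ^ (-ν - 1) * hermiteKernel x t) ∩ Set.Ioi 0 =
          Set.Ioi 0 := by
        refine Set.inter_eq_right.2 fun t ht => ?_
        exact (mul_pos (Real.rpow_pos_of_pos ht _) (hermiteKernel_pos x t)).ne'
      rw [this]
      simp
    · refine (MeasureTheory.ae_restrict_iff' measurableSet_Ioi).2
        (Eventually.of_forall fun t ht => ?_)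
      exact (mul_pos (Real.rpow_pos_of_pos ht _) (hermiteKernel_pos x t)).le
  have hG : 0 < Real.Gamma (-ν) := Real.Gamma_pos_of_pos (by linarith)
  refine ⟨_, div_pos hpos hG, ?_⟩
  have h2 := hH.2
  rw [mellin, MeasureTheory.setIntegral_congr_fun measurableSet_Ioi e, integral_complex_ofReal,
    ← Complex.ofReal_neg, Complex.Gamma_ofReal] at h2
  have hG' : (Real.Gamma (-ν) : ℂ) ≠ 0 := by exact_mod_cast hG.ne'
  rw [Complex.ofReal_div, h2]
  field_simp

/-- For real degree and `t² ≥ 2ν` the recurrence preserves the inequality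
`0 < t H_{ν-1}(t) ≤ H_ν(t)`. -/
lemma hermiteFn_ratio {t : ℝ} (ht : 1 ≤ t) (m : ℕ) : ∀ ν : ℝ, ν < m → 2 * ν ≤ t ^ 2 →
    ∃ r s : ℝ, hermiteFn (ν : ℂ) t = r ∧ hermiteFn ((ν - 1 : ℝ) : ℂ) t = s ∧ 0 < s ∧
      t * s ≤ r := by
  have hrec (ν r s : ℝ) (h1 : hermiteFn ((ν - 1 : ℝ) : ℂ) t = r)
      (h2 : hermiteFn ((ν - 1 - 1 : ℝ) : ℂ) t = s) :
      hermiteFn (ν : ℂ) t = ((2 * t * r - 2 * (ν - 1) * s : ℝ) : ℂ) := by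
    have := hermiteFn_add_one ((ν - 1 : ℝ) : ℂ) t
    rw [h1] at this
    push_cast at this h2 ⊢
    rwa [h2, sub_add_cancel] at this
  induction m with
  | zero =>
    intro ν hν _
    rw [Nat.cast_zero] at hν
    obtain ⟨s, hs, es⟩ := hermiteFn_pos_of_neg t (show ν - 1 < 0 by linarith)
    obtain ⟨q, hq, e_q⟩ := hermiteFn_pos_of_neg t (show ν - 1 - 1 < 0 by linarith)
    refine ⟨_, s, hrec ν s q es e_q, es, hs, ?_⟩
    nlinarith [mul_pos (show 0 < 1 - ν by linarith) hq, mul_pos (show 0 < t by linarith) hs]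
  | succ m ih =>
    intro ν hν h2
    push_cast at hν
    obtain ⟨r, s, er, es, hs, hrs⟩ := ih (ν - 1) (by linarith) (by linarith)
    have hts : 0 < t * s := by positivity
    refine ⟨_, r, hrec ν r s er es, er, by linarith, ?_⟩
    nlinarith [mul_le_mul_of_nonneg_left hrs (show 0 ≤ t by linarith),
      mul_le_mul_of_nonneg_right h2 hs.le]

lemma exists_hermiteFn_pos (x ν : ℝ) :
    ∃ t : ℝ, x + 1 ≤ t ∧ ∃ h : ℝ, 0 < h ∧ hermiteFn (ν : ℂ) t = h := by
  obtain ⟨m, hm⟩ := exists_nat_gt ν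
  have h1 := abs_nonneg x
  have h2 := le_abs_self x
  have h3 := abs_nonneg ν
  have h4 := le_abs_self ν
  obtain ⟨r, s, er, -, hs, hrs⟩ := hermiteFn_ratio (t := |x| + 2 * |ν| + 1) (by linarith) m ν hm
    (by nlinarith)
  exact ⟨_, by linarith, r, lt_of_lt_of_le (by positivity) hrs, er⟩

/-! ### Simplicity of the zeros of the Hermite function in the degree -/

/-- The Wronskian, with respect to the variable, of two consecutive scaled Charlier polynomials. -/
noncomputable def charlierWronskian (b : ℝ) (k : ℕ) (z : ℂ) : ℂ :=
  deriv (scaledCharlier b k) z * scaledCharlier b (k + 1) z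
    - deriv (scaledCharlier b (k + 1)) z * scaledCharlier b k z

lemma charlierWronskian_zero {b : ℝ} (hb : 0 < b) (z : ℂ) :
    (b : ℂ) ^ 2 / 2 * charlierWronskian b 0 z = scaledCharlier b 0 z ^ 2 := by
  have hb' : (b : ℂ) ≠ 0 := by exact_mod_cast hb.ne'
  have h1 (w : ℂ) : (b : ℂ) ^ 2 / 2 * scaledCharlier b 1 w =
      ((b : ℂ) ^ 2 / 2 - w) * scaledCharlier b 0 w := by
    have h := charlier_succ (b ^ 2 / 2) 0 w
    rw [zero_add, charlier_zero, charlier_zero] at h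
    rw [scaledCharlier, scaledCharlier, h, charlier_zero]
    push_cast
    field_simp
  have d1 := (differentiable_scaledCharlier hb 1 z).hasDerivAt.const_mul ((b : ℂ) ^ 2 / 2)
  have d2 := ((hasDerivAt_id z).const_sub ((b : ℂ) ^ 2 / 2)).mul
    (differentiable_scaledCharlier hb 0 z).hasDerivAt
  have h2 := (d1.congr_of_eventuallyEq (Eventually.of_forall fun w => (h1 w).symm)).unique d2
  have h3 := h1 z
  simp only [id] at h2
  rw [charlierWronskian, zero_add]
  linear_combination deriv (scaledCharlier b 0) z * h3 - scaledCharlier b 0 z * h2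

/-- The three-term recurrence and its derivative in `z` combine to the confluent form of the
Christoffel–Darboux recursion. -/
lemma charlierWronskian_succ {b : ℝ} (hb : 0 < b) (k : ℕ) (z : ℂ) :
    (b : ℂ) ^ 2 / 2 * charlierWronskian b (k + 1) z =
      scaledCharlier b (k + 1) z ^ 2 + (k + 1) * charlierWronskian b k z := by
  have h1 := scaledCharlier_succ_succ hb k
  have d1 := (differentiable_scaledCharlier hb (k + 2) z).hasDerivAt.const_mul ((b : ℂ) ^ 2 / 2)
  have d2 := (((hasDerivAt_id z).const_sub ((k : ℂ) + 1 + (b : ℂ) ^ 2 / 2)).mul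
    (differentiable_scaledCharlier hb (k + 1) z).hasDerivAt).sub
    ((differentiable_scaledCharlier hb k z).hasDerivAt.const_mul ((k : ℂ) + 1))
  have h2 := (d1.congr_of_eventuallyEq (Eventually.of_forall fun w => (h1 w).symm)).unique d2
  have h3 := h1 z
  simp only [id] at h2
  rw [charlierWronskian, charlierWronskian]
  linear_combination deriv (scaledCharlier b (k + 1)) z * h3 - scaledCharlier b (k + 1) z * h2

lemma charlierWronskian_succ_re {b : ℝ} (hb : 0 < b) (k : ℕ) (ν : ℝ) :
    (charlierWronskian b (k + 1) ν).re =
      (scaledCharlier b (k + 1) ν).re ^ 2 / (b ^ 2 / 2)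
        + (k + 1) / (b ^ 2 / 2) * (charlierWronskian b k ν).re := by
  have h := congrArg Complex.re (charlierWronskian_succ hb k ν)
  have him := scaledCharlier_ofReal_im hb (k + 1) ν
  have e1 : (b : ℂ) ^ 2 / 2 = ((b ^ 2 / 2 : ℝ) : ℂ) := by push_cast; rfl
  have e2 : (k : ℂ) + 1 = ((k + 1 : ℝ) : ℂ) := by push_cast; rfl
  rw [e1, e2, Complex.re_ofReal_mul, Complex.add_re, Complex.re_ofReal_mul,
    pow_two (scaledCharlier b (k + 1) ν), Complex.mul_re, him] at h
  field_simp at h ⊢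
  linarith

lemma charlierWronskian_re_nonneg {b : ℝ} (hb : 0 < b) (k : ℕ) (ν : ℝ) :
    0 ≤ (charlierWronskian b k ν).re := by
  induction k with
  | zero =>
    have h := congrArg Complex.re (charlierWronskian_zero hb ν)
    have e1 : (b : ℂ) ^ 2 / 2 = ((b ^ 2 / 2 : ℝ) : ℂ) := by push_cast; rfl
    rw [e1, Complex.re_ofReal_mul, pow_two (scaledCharlier b 0 ν), Complex.mul_re,
      scaledCharlier_ofReal_im hb] at h
    refine (mul_nonneg_iff_of_pos_left (show 0 < b ^ 2 / 2 by positivity)).1 ?_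
    rw [h]
    nlinarith [mul_self_nonneg (scaledCharlier b 0 (ν : ℂ)).re]
  | succ k ih =>
    rw [charlierWronskian_succ_re hb]
    positivity

/-- A linear recurrence with contraction factor `r` that gains at least `s` in each of the
first `m` steps. -/
lemma le_of_recurrence {w : ℕ → ℝ} {r s : ℝ} (hr0 : 0 ≤ r) (hr1 : r ≤ 1) (hs : 0 ≤ s)
    {k₀ m l : ℕ} (h0 : 0 ≤ w k₀)
    (h1 : ∀ k, k₀ ≤ k → k < k₀ + m + l → r * w k ≤ w (k + 1))
    (h2 : ∀ k, k₀ ≤ k → k < k₀ + m → r * w k + s ≤ w (k + 1)) :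
    r ^ (m + l) * (m * s) ≤ w (k₀ + m + l) := by
  have a1 (j : ℕ) : j ≤ m → r ^ j * (j * s) ≤ w (k₀ + j) := by
    induction j with
    | zero => intro _; simpa using h0
    | succ j ih =>
      intro hj
      have e1 := ih (by omega)
      have e2 := h2 (k₀ + j) (by omega) (by omega)
      have e3 : r ^ (j + 1) ≤ 1 := pow_le_one₀ hr0 hr1
      have e4 := mul_le_mul_of_nonneg_right e3 hs
      have e5 := mul_le_mul_of_nonneg_left e1 hr0
      rw [← add_assoc]
      push_cast
      calc r ^ (j + 1) * ((j + 1) * s) = r * (r ^ j * (j * s)) + r ^ (j + 1) * s := by ring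
        _ ≤ _ := by linarith
  have a2 (i : ℕ) : i ≤ l → r ^ (m + i) * (m * s) ≤ w (k₀ + m + i) := by
    induction i with
    | zero => intro _; exact a1 m le_rfl
    | succ i ih =>
      intro hi
      have e1 := ih (by omega)
      have e2 := h1 (k₀ + m + i) (by omega) (by omega)
      have e5 := mul_le_mul_of_nonneg_left e1 hr0
      rw [← add_assoc, ← add_assoc, pow_succ]
      linarith
  exact a2 l le_rfl

lemma exp_neg_le_pow {y c : ℝ} (hy0 : 0 ≤ y) (hy : y ≤ 1 / 2) {N : ℕ} (hN : N * y ≤ c) :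
    Real.exp (-(2 * c)) ≤ (1 - y) ^ N := by
  have h1 : 0 < 1 - y := by linarith
  have h2 := Real.one_sub_inv_le_log_of_pos h1
  have h3 : -(2 * y) ≤ 1 - (1 - y)⁻¹ := by
    rw [← sub_nonneg]
    have : 1 - (1 - y)⁻¹ - -(2 * y) = y * (1 - 2 * y) / (1 - y) := by field_simp; ring
    rw [this]
    exact div_nonneg (mul_nonneg hy0 (by linarith)) h1.le
  rw [← Real.exp_log h1, ← Real.exp_nat_mul, Real.exp_le_exp]
  have h4 := mul_le_mul_of_nonneg_left (h3.trans h2) (N.cast_nonneg : (0 : ℝ) ≤ N)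
  linarith

/-- The Wronskian at a real point is a sum of squares. About `b` of the summands belong to degrees
for which `hermitePoint` is close to a point where the Hermite function is positive, and
each of these contributes a multiple of `1 / b ^ 2`. -/
lemma charlierWronskian_lower (x ν : ℝ) :
    ∃ c : ℝ, 0 < c ∧ ∀ᶠ b in atTop, ∀ n : ℕ, |hermitePoint b (n + 1) - x| ≤ 1 / b →
      c / b ≤ (charlierWronskian b n ν).re := by
  obtain ⟨t, hxt, h, hh, ht⟩ := exists_hermiteFn_pos x ν
  set A := |x| + |t| + 2 with hAdef
  have hx0 := abs_nonneg x
  have ht0 := abs_nonneg t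
  obtain ⟨M, hM, hconv⟩ := convergesOn_of_isCompact A (isCompact_singleton (x := (ν : ℂ)))
  obtain ⟨δ, hδ0, hδ1, hδM⟩ : ∃ δ : ℝ, 0 < δ ∧ δ ≤ 1 ∧ M * δ ≤ h / 4 := by
    refine ⟨min 1 (h / (4 * (M + 1))), by positivity, min_le_left _ _, ?_⟩
    calc M * min 1 (h / (4 * (M + 1))) ≤ (M + 1) * (h / (4 * (M + 1))) := by
          gcongr
          · linarith
          · exact min_le_right _ _
      _ = h / 4 := by field_simp
  refine ⟨Real.exp (-(8 * A ^ 2)) * (δ * h ^ 2 / 4), by positivity, ?_⟩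
  filter_upwards [eventually_ge_atTop (4 * (2 * A + 2)), eventually_ge_atTop (2 / δ)]
    with b hbA hbδ n hn
  have hA2 : 2 ≤ A := by linarith
  have hb0 : 0 < b := by linarith
  have hbδ' : 2 ≤ δ * b := by rwa [div_le_iff₀' hδ0] at hbδ
  have hinv : 1 / b ≤ 1 / 16 := by gcongr; linarith
  have hinvδ : 1 / b ≤ δ / 2 := by rw [div_le_div_iff₀ hb0 two_pos]; linarith
  have hX (k : ℕ) : b * hermitePoint b k = b ^ 2 / 2 - k := by
    rw [hermitePoint]; field_simp
  have hb1 : b * (1 / b) = 1 := by field_simp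
  have hn' := abs_le.1 hn
  have hxl := neg_abs_le x
  have htu := le_abs_self t
  have htl := neg_abs_le t
  have hxu := le_abs_self x
  -- The window of degrees consists of the `m` degrees following `k₀`.
  set k₀ := ⌈b ^ 2 / 2 - b * (t + δ)⌉₊ with hk₀
  set m := ⌊δ * b⌋₊ with hm
  have hpos : 0 ≤ b ^ 2 / 2 - b * (t + δ) := by nlinarith
  have k1 := Nat.le_ceil (b ^ 2 / 2 - b * (t + δ))
  have k2 := Nat.ceil_lt_add_one hpos
  have m1 := Nat.floor_le (show 0 ≤ δ * b by positivity)
  have m2 := Nat.lt_floor_add_one (δ * b)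
  rw [← hk₀] at k1 k2
  rw [← hm] at m1 m2
  have hn2 : b * (x - 1 / b) ≤ b * hermitePoint b (n + 1) ∧
      b * hermitePoint b (n + 1) ≤ b * (x + 1 / b) :=
    ⟨by gcongr; linarith, by gcongr; linarith⟩
  rw [hX] at hn2
  push_cast at hn2
  have hbx : b * (x + 1) ≤ b * t := by gcongr
  have hlen : k₀ + m ≤ n := by
    have h2 := hn2.2
    rw [mul_add, hb1] at h2
    have : (k₀ + m : ℝ) < n + 1 := by linarith
    exact Nat.lt_succ_iff.1 (by exact_mod_cast this)
  obtain ⟨l, rfl⟩ := Nat.exists_eq_add_of_le hlen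
  have hXle (k : ℕ) (hk : k₀ ≤ k) : hermitePoint b k ≤ t + δ := by
    have : (k₀ : ℝ) ≤ k := by exact_mod_cast hk
    refine le_of_mul_le_mul_left ?_ hb0
    rw [hX]
    linarith
  have hrec (k : ℕ) (hk : k₀ ≤ k) :
      (scaledCharlier b (k + 1) ν).re ^ 2 / (b ^ 2 / 2)
        + (1 - 2 * A / b) * (charlierWronskian b k ν).re ≤ (charlierWronskian b (k + 1) ν).re := by
    rw [charlierWronskian_succ_re hb0]
    have h1 := charlierWronskian_re_nonneg hb0 k ν
    gcongr
    have h2 := hXle (k + 1) (by omega)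
    have h3 : hermitePoint b (k + 1) ≤ A := by linarith
    have h4 : b * hermitePoint b (k + 1) ≤ b * A := by gcongr
    rw [hX] at h4
    push_cast at h4
    rw [le_div_iff₀ (by positivity)]
    have h5 : (1 - 2 * A / b) * (b ^ 2 / 2) = b ^ 2 / 2 - b * A := by field_simp
    linarith
  have hr0 : 2 * A / b ≤ 1 / 2 := by rw [div_le_div_iff₀ hb0 two_pos]; linarith
  have hr1 : 0 ≤ 2 * A / b := by positivity
  have hfin := le_of_recurrence (w := fun k => (charlierWronskian b k ν).re)
    (r := 1 - 2 * A / b) (s := (h / 2) ^ 2 / (b ^ 2 / 2)) (by linarith) (by linarith)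
    (by positivity) (k₀ := k₀) (m := m) (l := l) (charlierWronskian_re_nonneg hb0 _ ν)
    (fun k hk _ => by
      refine le_trans ?_ (hrec k hk)
      have : 0 ≤ (scaledCharlier b (k + 1) ν).re ^ 2 / (b ^ 2 / 2) := by positivity
      linarith)
    (fun k hk hk' => by
      refine le_trans ?_ (hrec k hk)
      rw [add_comm]
      gcongr
      have h1 := hXle (k + 1) (by omega)
      have h2 : t - δ ≤ hermitePoint b (k + 1) := by
        have : (k + 1 : ℝ) ≤ k₀ + m := by exact_mod_cast hk'
        refine le_of_mul_le_mul_left ?_ hb0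
        rw [hX]
        push_cast
        linarith
      have h3 : |hermitePoint b (k + 1) - t| ≤ δ := abs_le.2 ⟨by linarith, by linarith⟩
      have h4 : |hermitePoint b (k + 1)| ≤ A := abs_le.2 ⟨by linarith, by linarith⟩
      have h5 := (hconv b hbA (k + 1) t h4 (by linarith) ν rfl).2
      rw [ht] at h5
      have h6 := (Complex.abs_re_le_norm _).trans h5
      rw [Complex.sub_re, Complex.ofReal_re] at h6
      have h7 : M * (1 / b + |hermitePoint b (k + 1) - t|) ≤ h / 2 := by
        calc _ ≤ M * (δ + δ) := by gcongr; linarith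
          _ ≤ h / 2 := by linarith
      linarith [(abs_le.1 (h6.trans h7)).1])
  refine le_trans ?_ hfin
  -- From `k₀` to the final degree there are at most `2 A b` steps, each contracting
  -- by `1 - 2 A / b`.
  have hpow : Real.exp (-(8 * A ^ 2)) ≤ (1 - 2 * A / b) ^ (m + l) := by
    have hN : ((m + l : ℕ) : ℝ) ≤ 2 * A * b := by
      have h1 : b * (t + δ - x) ≤ b * (2 * A) := by gcongr; linarith
      have h2 := hn2.1
      rw [mul_sub, hb1] at h2
      push_cast at h2 ⊢
      linarith
    have := exp_neg_le_pow hr1 hr0 (N := m + l) (c := 4 * A ^ 2) (by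
      calc ((m + l : ℕ) : ℝ) * (2 * A / b) ≤ 2 * A * b * (2 * A / b) := by gcongr
        _ = 4 * A ^ 2 := by field_simp; ring)
    rwa [show 2 * (4 * A ^ 2) = 8 * A ^ 2 by ring] at this
  have hmδ : δ * b / 2 ≤ m := by linarith
  calc Real.exp (-(8 * A ^ 2)) * (δ * h ^ 2 / 4) / b
      = Real.exp (-(8 * A ^ 2)) * ((δ * b / 2) * ((h / 2) ^ 2 / (b ^ 2 / 2))) := by
        field_simp
        norm_num
    _ ≤ (1 - 2 * A / b) ^ (m + l) * (m * ((h / 2) ^ 2 / (b ^ 2 / 2))) := by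
        have := pow_nonneg (show 0 ≤ 1 - 2 * A / b by linarith) (m + l)
        gcongr

/-- At a double zero `ν` of the Hermite function, both `scaledCharlier b n` and its derivative would
be `O(1 / b)` at `ν`, and the Wronskian would be `O(1 / b ^ 2)`, contradicting
`charlierWronskian_lower`. -/
lemma deriv_hermiteFn_ne_zero {x ν : ℝ} (h0 : hermiteFn (ν : ℂ) x = 0) :
    deriv (fun z => hermiteFn z x) (ν : ℂ) ≠ 0 := by
  intro hd
  obtain ⟨c, hc, hlow⟩ := charlierWronskian_lower x ν
  obtain ⟨M, hM, hconv⟩ := exists_norm_scaledCharlier_sub_le x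
    (isCompact_closedBall (ν : ℂ) 2)
  have hsub1 : Metric.sphere (ν : ℂ) 1 ⊆ Metric.closedBall (ν : ℂ) 2 := fun z hz => by
    rw [mem_sphere_iff_norm] at hz
    rw [mem_closedBall_iff_norm]
    linarith
  have hmain : ∀ᶠ b in atTop,
      c / b ≤ 2 / b * (((|ν| + 1) * M) * (M / b) + (M / b) * (|ν| * M)) := by
    filter_upwards [hlow, hconv, eventually_ge_atTop (2 * |x| + 2),
      eventually_gt_atTop (4 * (|x| + 1))] with b hlow hconv hb hb2
    have hx := abs_nonneg x
    have hb0 : 0 < b := by linarith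
    have hXd := abs_hermitePoint_charlierDegree_sub_le x hb0 (by linarith)
    obtain ⟨n, hn⟩ : ∃ n, charlierDegree x (b ^ 2 / 2) = n + 1 := by
      refine Nat.exists_eq_succ_of_ne_zero fun h => ?_
      rw [h, hermitePoint, Nat.cast_zero, sub_zero] at hXd
      have h1 : b ^ 2 / 2 / b = b / 2 := by field_simp
      have h2 : 1 / b ≤ 1 := by rw [div_le_one hb0]; linarith
      rw [h1] at hXd
      linarith [(abs_le.1 hXd).2, le_abs_self x]
    rw [hn] at hXd
    have hXn : |hermitePoint b n - x| ≤ 2 / b := by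
      have : hermitePoint b n - x = (hermitePoint b (n + 1) - x) + 1 / b := by
        simp only [hermitePoint]; push_cast; field_simp; ring
      rw [this]
      refine (abs_add_le _ _).trans ?_
      rw [abs_of_pos (show 0 < 1 / b by positivity)]
      calc _ ≤ 1 / b + 1 / b := by gcongr
        _ = 2 / b := by ring
    have hF := hconv n hXn
    set F := scaledCharlier b n with hFdef
    have dF : Differentiable ℂ F := differentiable_scaledCharlier hb0 n
    have dH := differentiable_hermiteFn x
    set G : ℂ → ℂ := fun z => z * F (z - 1) with hGdef
    have dG : Differentiable ℂ G := differentiable_id.mul (dF.comp (differentiable_id.sub_const 1))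
    -- Consecutive degrees differ by `(2 / b) G`, so the Wronskian carries a factor `2 / b`.
    have hW : charlierWronskian b n ν =
        2 / b * (deriv G ν * F ν - deriv F ν * G ν) := by
      have e : scaledCharlier b (n + 1) = fun z => F z - 2 / b * G z := by
        funext z
        rw [scaledCharlier_succ hb0]
        simp only [hGdef, hFdef]
        ring
      have hder : deriv (scaledCharlier b (n + 1)) ν = deriv F ν - 2 / b * deriv G ν := by
        rw [e]
        exact ((dF _).hasDerivAt.sub ((dG _).hasDerivAt.const_mul _)).deriv
      rw [charlierWronskian, hder, e]
      ring
    have b1 : ‖F ν‖ ≤ M / b := by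
      have := (hF ν (by simp)).2
      rwa [h0, sub_zero] at this
    have b2 : ‖deriv F ν‖ ≤ M / b := by
      have h1 : deriv (fun z => F z - hermiteFn z x) (ν : ℂ) = deriv F ν := by
        rw [deriv_fun_sub (dF _) (dH _), hd, sub_zero]
      rw [← h1, ← div_one (M / b)]
      exact Complex.norm_deriv_le_of_forall_mem_sphere_norm_le one_pos
        (dF.sub dH).diffContOnCl fun z hz => (hF z (hsub1 hz)).2
    have b3 : ‖G ν‖ ≤ |ν| * M := by
      rw [hGdef, norm_mul, Complex.norm_real, Real.norm_eq_abs]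
      gcongr
      refine (hF _ ?_).1
      rw [mem_closedBall_iff_norm]
      simp
    have b4 : ‖deriv G ν‖ ≤ (|ν| + 1) * M := by
      rw [← div_one ((|ν| + 1) * M)]
      refine Complex.norm_deriv_le_of_forall_mem_sphere_norm_le one_pos dG.diffContOnCl
        fun z hz => ?_
      rw [mem_sphere_iff_norm] at hz
      rw [hGdef, norm_mul]
      gcongr
      · have := norm_add_le (z - ν) ν
        rw [sub_add_cancel, hz, Complex.norm_real, Real.norm_eq_abs] at this
        linarith
      · refine (hF _ ?_).1
        rw [mem_closedBall_iff_norm]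
        have := norm_sub_le (z - ν) 1
        rw [hz, norm_one] at this
        rw [sub_right_comm]
        linarith
    refine (hlow n hXd).trans ((Complex.re_le_norm _).trans ?_)
    rw [hW, norm_mul]
    have n2 : ‖(2 / b : ℂ)‖ = 2 / b := by
      rw [norm_div, Complex.norm_real, Real.norm_eq_abs, abs_of_pos hb0]; simp
    rw [n2]
    gcongr
    refine (norm_sub_le _ _).trans ?_
    rw [norm_mul, norm_mul]
    gcongr
  obtain ⟨b, hb, hb0, hbig⟩ := (hmain.and ((eventually_gt_atTop 0).and
    (eventually_gt_atTop ((2 * (((|ν| + 1) * M) * M + M * (|ν| * M))) / c)))).exists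
  have e : 2 / b * (((|ν| + 1) * M) * (M / b) + (M / b) * (|ν| * M)) =
      (2 * (((|ν| + 1) * M) * M + M * (|ν| * M)) / b) / b := by ring
  rw [e, div_le_div_iff_of_pos_right hb0, le_div_iff₀ hb0] at hb
  rw [div_lt_iff₀ hc] at hbig
  linarith

/-! ### Zeros of Charlier polynomials near zeros of the Hermite function -/

/-- Passage from the parameter `b = √(2a)` and general degrees close to `x` back to `a` and the
degree `charlierDegree x a`. -/
lemma eventually_charlierDegree (x : ℝ) {P : ℝ → ℕ → Prop}
    (hP : ∀ᶠ b in atTop, ∀ n : ℕ, |hermitePoint b n - x| ≤ 2 / b → P b n) :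
    ∀ᶠ a in atTop, P √(2 * a) (charlierDegree x a) := by
  have ht : Tendsto (fun a : ℝ => √(2 * a)) atTop atTop :=
    Real.tendsto_sqrt_atTop.comp (tendsto_id.const_mul_atTop two_pos)
  filter_upwards [ht.eventually hP,
    ht.eventually (eventually_abs_hermitePoint_charlierDegree_sub_le x),
    eventually_gt_atTop 0] with a h1 h2 ha
  have e : √(2 * a) ^ 2 / 2 = a := by rw [Real.sq_sqrt (by positivity)]; ring
  rw [e] at h2
  exact h1 _ (h2.trans (by gcongr; norm_num))

lemma scaledCharlier_sqrt_eq_zero_iff {a : ℝ} (ha : 0 < a) {n : ℕ} {z : ℂ} :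
    scaledCharlier √(2 * a) n z = 0 ↔ charlier a n z = 0 := by
  rw [scaledCharlier_eq_zero_iff (by positivity), Real.sq_sqrt (by positivity),
    mul_div_cancel_left₀ _ two_ne_zero]

lemma div_sqrt_two_mul_le {M a : ℝ} (hM : 0 ≤ M) (ha : 0 < a) :
    M / √(2 * a) ≤ M * ‖1 / √a‖ := by
  rw [Real.norm_eq_abs, abs_of_nonneg (by positivity), div_eq_mul_one_div]
  gcongr
  linarith

lemma hasDerivAt_hermiteFn_re (x ν : ℝ) :
    HasDerivAt (fun s : ℝ => (hermiteFn (s : ℂ) x).re)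
      (deriv (fun z => hermiteFn z x) (ν : ℂ)).re ν :=
  HasDerivAt.real_of_complex (differentiable_hermiteFn x (ν : ℂ)).hasDerivAt

lemma deriv_hermiteFn_im (x ν : ℝ) : (deriv (fun z => hermiteFn z x) (ν : ℂ)).im = 0 := by
  have h := HasDerivAt.real_of_complex
    ((differentiable_hermiteFn x (ν : ℂ)).hasDerivAt.const_mul (-Complex.I))
  simp only [Complex.mul_re, Complex.neg_re, Complex.neg_im, Complex.I_re, Complex.I_im,
    hermiteFn_ofReal_im] at h
  have := h.unique (by simpa using hasDerivAt_const ν (0 : ℝ))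
  simpa using this

lemma deriv_hermiteFn_re_ne_zero {x ν : ℝ} (h0 : hermiteFn (ν : ℂ) x = 0) :
    (deriv (fun z => hermiteFn z x) (ν : ℂ)).re ≠ 0 := fun h =>
  deriv_hermiteFn_ne_zero h0 (Complex.ext h (deriv_hermiteFn_im x ν))

/-- A zero of the Hermite function is a sign change with nonzero slope, so it attracts a real
zero of the Charlier polynomials at distance `O(1 / √a)`. -/
lemma exists_charlier_zero_near {x ν : ℝ} (h0 : hermiteFn (ν : ℂ) x = 0) :
    ∃ C : ℝ, 0 ≤ C ∧ ∀ᶠ a in atTop, ∃ s : ℝ,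
      charlier a (charlierDegree x a) (s : ℂ) = 0 ∧ |ν - s| ≤ C / √(2 * a) := by
  set d := (deriv (fun z => hermiteFn z x) (ν : ℂ)).re with hd
  have hd0 : d ≠ 0 := deriv_hermiteFn_re_ne_zero h0
  have hdpos : 0 < |d| := abs_pos.2 hd0
  obtain ⟨M, hM, hconv⟩ := exists_norm_scaledCharlier_sub_le x (isCompact_closedBall (ν : ℂ) 1)
  set C := 4 * M / |d| with hC
  have hC0 : 0 < C := by positivity
  refine ⟨C, hC0.le, ?_⟩
  have hlin := (hasDerivAt_hermiteFn_re x ν).isLittleO.def (show 0 < |d| / 2 by positivity)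
  simp only [h0, Complex.zero_re, sub_zero, smul_eq_mul, Real.norm_eq_abs] at hlin
  obtain ⟨ε, hε, hlin⟩ := Metric.eventually_nhds_iff.1 hlin
  have hev : ∀ᶠ b in atTop, ∀ n : ℕ, |hermitePoint b n - x| ≤ 2 / b →
      ∃ s : ℝ, scaledCharlier b n s = 0 ∧ |ν - s| ≤ C / b := by
    filter_upwards [hconv, eventually_gt_atTop 0, eventually_gt_atTop (C / ε),
      eventually_ge_atTop C] with b hb hb0 hbε hbC n hn
    have hCb : 0 < C / b := by positivity
    have hCε : C / b < ε := by
      rw [div_lt_iff₀ hε] at hbε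
      rw [div_lt_iff₀ hb0]
      linarith
    have hC1 : C / b ≤ 1 := by rwa [div_le_one hb0]
    -- At distance exactly `C / b` the linear term of the Hermite function dominates the error.
    have hsign (τ : ℝ) (hτ : |τ| = 1) :
        0 ≤ τ * (d * (scaledCharlier b n ((ν + τ * (C / b) : ℝ) : ℂ)).re) := by
      set s := ν + τ * (C / b) with hs
      have hsν : s - ν = τ * (C / b) := by rw [hs]; ring
      have habs : |s - ν| = C / b := by rw [hsν, abs_mul, hτ, one_mul, abs_of_pos hCb]
      have h1 := hlin (y := s) (by rwa [Real.dist_eq, habs])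
      rw [habs, hsν] at h1
      have h2 := (hb n hn (s : ℂ) (by
        rw [mem_closedBall_iff_norm, ← Complex.ofReal_sub, Complex.norm_real, Real.norm_eq_abs,
          habs]
        exact hC1)).2
      have h3 := (Complex.abs_re_le_norm _).trans h2
      rw [Complex.sub_re] at h3
      set f := (scaledCharlier b n (s : ℂ)).re
      set g := (hermiteFn (s : ℂ) x).re
      have h4 : |f - τ * (C / b) * d| ≤ |d| * (C / b) := by
        have h5 : M / b ≤ |d| / 2 * (C / b) := by
          rw [hC]
          have : |d| / 2 * (4 * M / |d| / b) = 2 * (M / b) := by field_simp; ring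
          rw [this]
          linarith [show 0 < M / b by positivity]
        calc |f - τ * (C / b) * d| = |(f - g) + (g - τ * (C / b) * d)| := by ring_nf
          _ ≤ |f - g| + |g - τ * (C / b) * d| := abs_add_le _ _
          _ ≤ |d| / 2 * (C / b) + |d| / 2 * (C / b) := by linarith
          _ = _ := by ring
      have h6 : |τ * d * (f - τ * (C / b) * d)| ≤ d ^ 2 * (C / b) := by
        rw [abs_mul, abs_mul, hτ, one_mul, ← sq_abs d, pow_two, mul_assoc |d|]
        gcongr
      have hτ2 : τ ^ 2 = 1 := by rw [← sq_abs, hτ, one_pow]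
      have h7 : τ * (d * f) = τ * d * (f - τ * (C / b) * d) + τ ^ 2 * (d ^ 2 * (C / b)) := by ring
      rw [h7, hτ2]
      linarith [(abs_le.1 h6).1]
    have hcont : Continuous fun s : ℝ => d * (scaledCharlier b n (s : ℂ)).re :=
      continuous_const.mul (Complex.continuous_re.comp
        ((differentiable_scaledCharlier hb0 n).continuous.comp Complex.continuous_ofReal))
    have hp := hsign 1 (by simp)
    have hm := hsign (-1) (by simp)
    rw [one_mul, one_mul] at hp
    rw [neg_one_mul, neg_one_mul, neg_nonneg] at hm
    obtain ⟨s, hs, hs0⟩ := intermediate_value_Icc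
      (show ν + -(C / b) ≤ ν + C / b by linarith) hcont.continuousOn ⟨hm, hp⟩
    refine ⟨s, Complex.ext ?_ (scaledCharlier_ofReal_im hb0 n s), ?_⟩
    · exact (mul_eq_zero.1 hs0).resolve_left hd0
    · rw [abs_le]
      constructor <;> linarith [hs.1, hs.2]
  filter_upwards [eventually_charlierDegree x hev, eventually_gt_atTop 0] with a h ha
  obtain ⟨s, h1, h2⟩ := h
  exact ⟨s, (scaledCharlier_sqrt_eq_zero_iff ha).1 h1, h2⟩

/-- Since the scaled Charlier polynomial vanishes at its zeros, the Hermite function takes there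
only values of the size of the approximation error. -/
lemma eventually_norm_hermiteFn_le (x : ℝ) (ν : ℂ) :
    ∃ M : ℝ, 0 < M ∧ ∀ᶠ a in atTop, ∀ z ∈ Metric.closedBall ν 1,
      charlier a (charlierDegree x a) z = 0 → ‖hermiteFn z x‖ ≤ M * ‖1 / √a‖ := by
  obtain ⟨M, hM, hconv⟩ := exists_norm_scaledCharlier_sub_le x (isCompact_closedBall ν 1)
  refine ⟨M, hM, ?_⟩
  filter_upwards [eventually_charlierDegree x hconv, eventually_gt_atTop 0] with a h ha z hz h0
  have := (h z hz).2
  rw [(scaledCharlier_sqrt_eq_zero_iff ha).2 h0, zero_sub, norm_neg] at this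
  exact this.trans (div_sqrt_two_mul_le hM.le ha)

lemma tendsto_one_div_sqrt : Tendsto (fun a : ℝ => 1 / √a) atTop (𝓝 0) := by
  simpa only [one_div, Function.comp_def] using tendsto_inv_atTop_zero.comp Real.tendsto_sqrt_atTop

theorem mainTheorem2 (x : ℝ) :
    (∀ (ι : Type*) (l : Filter ι) [l.NeBot] (a : ι → ℝ) (z : ι → ℂ) (ν : ℂ),
      Tendsto a l atTop →
      (∀ᶠ i in l, charlier (a i) (charlierDegree x (a i)) (z i) = 0) →
      Tendsto z l (𝓝 ν) →
      hermiteFn ν (x : ℂ) = 0 ∧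
        (fun i => ν - z i) =O[l] (fun i => 1 / √(a i))) ∧
    (∀ ν : ℝ, hermiteFn (ν : ℂ) (x : ℂ) = 0 →
      ∃ z : ℝ → ℝ,
        (∀ᶠ a in atTop, charlier a (charlierDegree x a) (z a : ℂ) = 0) ∧
        Tendsto z atTop (𝓝 ν) ∧
        (fun a => ν - z a) =O[atTop] (fun a => 1 / √a)) := by
  refine ⟨fun ι l _ a z ν ha hzero hz => ?_, fun ν hν => ?_⟩
  · obtain ⟨M, hM, hbound⟩ := eventually_norm_hermiteFn_le x ν
    have hO : (fun i => hermiteFn (z i) x) =O[l] (fun i => 1 / √(a i)) := by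
      refine IsBigO.of_bound M ?_
      filter_upwards [ha.eventually hbound, hzero,
        hz.eventually (Metric.closedBall_mem_nhds ν one_pos)] with i h1 h2 h3
      exact h1 _ h3 h2
    have hlim : Tendsto (fun i => hermiteFn (z i) x) l (𝓝 (hermiteFn ν x)) :=
      ((differentiable_hermiteFn x).continuous.tendsto ν).comp hz
    have hH : hermiteFn ν x = 0 :=
      tendsto_nhds_unique hlim (hO.trans_tendsto (tendsto_one_div_sqrt.comp ha))
    refine ⟨hH, ?_⟩
    -- The zeros are real, hence so is their limit.
    have him : ν.im = 0 := by
      refine tendsto_nhds_unique ((Complex.continuous_im.tendsto ν).comp hz)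
        (tendsto_const_nhds.congr' ?_)
      filter_upwards [hzero, ha.eventually (eventually_gt_atTop 0)] with i h1 h2
      exact (im_eq_zero_of_charlier_eq_zero h2 h1).symm
    obtain ⟨r, rfl⟩ : ∃ r : ℝ, (r : ℂ) = ν := ⟨ν.re, Complex.ext rfl him.symm⟩
    have hrev := (HasDerivAtFilter.isTheta_sub (differentiable_hermiteFn x (r : ℂ)).hasDerivAt
      (deriv_hermiteFn_ne_zero hH)).isBigO_symm
    have hpair : Tendsto (fun i => (z i, (r : ℂ))) l (𝓝 (r : ℂ) ×ˢ pure (r : ℂ)) :=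
      hz.prodMk (tendsto_pure.2 (Eventually.of_forall fun _ => rfl))
    have hcomp := hrev.comp_tendsto hpair
    simp only [Function.comp_def, hH, sub_zero] at hcomp
    exact (hcomp.trans hO).neg_left.congr_left fun i => neg_sub _ _
  · obtain ⟨C, hC, hev⟩ := exists_charlier_zero_near hν
    classical
    let z : ℝ → ℝ := fun a => if h : ∃ s : ℝ, charlier a (charlierDegree x a) (s : ℂ) = 0 ∧
      |ν - s| ≤ C / √(2 * a) then h.choose else 0
    have hz : ∀ᶠ a in atTop, charlier a (charlierDegree x a) (z a : ℂ) = 0 ∧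
        |ν - z a| ≤ C / √(2 * a) := by
      filter_upwards [hev] with a h
      simp only [z, dif_pos h]
      exact h.choose_spec
    have hO : (fun a => ν - z a) =O[atTop] (fun a => 1 / √a) := by
      refine IsBigO.of_bound C ?_
      filter_upwards [hz, eventually_gt_atTop 0] with a h ha
      exact h.2.trans (div_sqrt_two_mul_le hC ha)
    refine ⟨z, hz.mono fun a h => h.1, ?_, hO⟩
    have := (hO.trans_tendsto tendsto_one_div_sqrt).const_sub ν
    simpa using this
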